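/- Let $n\ge 3$, let $\Omega\subset\mathbb R^n$ be an open set (possibly unbounded), let $1\le d\le\infty$, and let $a:\Omega\to\mathbb R$ be a measurable function in the Lorentz space $L^{\frac n2,d}(\Omega)$. That is, with $m(\sigma,a)=\operatorname{meas}\{x\in\Omega:|a(x)|>\sigma\}$ for $\sigma>0$ and $a^*(t)=\inf\{\sigma>0: m(\sigma,a)<t\}$ for $t>0$ (where $\inf\emptyset=\infty$), one has $\int_0^\infty a^*(t)^d\,t^{\frac{2d}{n}-1}\,dt<\infty$ if $d<\infty$, and $\sup_{t>0}a^*(t)\,t^{2/n}<\infty$ if $d=\infty$. Let $H^1_0(\Omega)$ be the completion of $C_c^\infty(\Omega)$ with respect to the norm $\|\nabla u\|_{L^2(\Omega)}$, realized, by the Sobolev inequality, as a space of functions in $L^{2n/(n-2)}(\Omega)$ (all functions are real-valued). Let $L^2_{|a|}(\Omega)$ be the $L^2$ space of the measure $|a(x)|\,dx$ on $\Omega$, with norm given by $$\|u\|_{L^2_{|a|}(\Omega)}^2=\int_\Omega |a(x)|\,|u(x)|^2\,dx .$$ Then $H^1_0(\Omega)$ embeds continuously in $L^2_{|a|}(\Omega)$: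 for every $u\in H^1_0(\Omega)$ the integral $\int_\Omega|a||u|^2\,dx$ is finite, and the natural linear map $H^1_0(\Omega)\to L^2_{|a|}(\Omega)$, $u\mapsto u$, is bounded. If moreover $d<\infty$, this map is compact. The same two assertions hold if $H^1_0(\Omega)$ is instead understood as the closure of $C_c^\infty(\Omega)$ in $H^1(\Omega)$, with the norm $(\|u\|_{L^2(\Omega)}^2+\|\nabla u\|_{L^2(\Omega)}^2)^{1/2}$. -/

import Mathlib

open MeasureTheory Set Filter Topology
open scoped ENNReal NNReal

noncomputable section

namespace YamabeRough

/-- The distribution function `m(σ, g) = meas {x ∈ Ω : |g x| > σ}`. -/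
def distrib {n : ℕ} (Ω : Set (EuclideanSpace ℝ (Fin n))) (g : EuclideanSpace ℝ (Fin n) → ℝ)
    (σ : ℝ) : ℝ≥0∞ :=
  volume {x | x ∈ Ω ∧ σ < |g x|}

/-- The decreasing rearrangement `g^*(t) = inf {σ > 0 : m(σ, g) < t}`, with `inf ∅ = ∞`. -/
def rearrangement {n : ℕ} (Ω : Set (EuclideanSpace ℝ (Fin n)))
    (g : EuclideanSpace ℝ (Fin n) → ℝ) (t : ℝ) : ℝ≥0∞ :=
  ⨅ (σ : ℝ) (_ : 0 < σ) (_ : distrib Ω g σ < ENNReal.ofReal t), ENNReal.ofReal σ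

/-- The Lorentz quasi-norm `‖g‖_{L^{p,d}(Ω)}` for `1 ≤ p < ∞` and `1 ≤ d ≤ ∞`:
`(∫₀^∞ g^*(t)^d t^{d/p - 1} dt)^{1/d}` if `d < ∞`, and `sup_{t > 0} g^*(t) t^{1/p}` if `d = ∞`. -/
def lorentzNorm {n : ℕ} (Ω : Set (EuclideanSpace ℝ (Fin n)))
    (g : EuclideanSpace ℝ (Fin n) → ℝ) (p : ℝ) (d : ℝ≥0∞) : ℝ≥0∞ :=
  if d = ∞ then
    ⨆ (t : ℝ) (_ : 0 < t), rearrangement Ω g t * ENNReal.ofReal (t ^ (1 / p))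
  else
    (∫⁻ t in Ioi (0 : ℝ),
      rearrangement Ω g t ^ d.toReal * ENNReal.ofReal (t ^ (d.toReal / p - 1))) ^ (1 / d.toReal)

/-- Membership in the Lorentz space `L^{p,d}(Ω)`; only the values of `g` on `Ω` matter. -/
def MemLorentz {n : ℕ} (Ω : Set (EuclideanSpace ℝ (Fin n)))
    (g : EuclideanSpace ℝ (Fin n) → ℝ) (p : ℝ) (d : ℝ≥0∞) : Prop :=
  AEMeasurable g (volume.restrict Ω) ∧ lorentzNorm Ω g p d < ∞

/-- The weighted measure `|a(x)| dx` on `Ω`. -/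
def weightedMeasure {n : ℕ} (Ω : Set (EuclideanSpace ℝ (Fin n)))
    (a : EuclideanSpace ℝ (Fin n) → ℝ) : Measure (EuclideanSpace ℝ (Fin n)) :=
  (volume.restrict Ω).withDensity (fun x => ENNReal.ofReal |a x|)

/-- The weighted space `L²_{|a|}(Ω)`: (classes of) functions with `∫_Ω |a| |u|² dx < ∞`. -/
abbrev WeightedL2 {n : ℕ} (Ω : Set (EuclideanSpace ℝ (Fin n)))
    (a : EuclideanSpace ℝ (Fin n) → ℝ) : Type :=
  Lp ℝ 2 (weightedMeasure Ω a)

/-- `φ ∈ C_c^∞(Ω)`. -/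
structure IsTestFunction {n : ℕ} (Ω : Set (EuclideanSpace ℝ (Fin n)))
    (φ : EuclideanSpace ℝ (Fin n) → ℝ) : Prop where
  smooth : ContDiff ℝ ((⊤ : ℕ∞) : WithTop ℕ∞) φ
  compact : HasCompactSupport φ
  supp : tsupport φ ⊆ Ω

/-- The ambient space `L^p(Ω) × L²(Ω; ℝⁿ)` of pairs `(u, ∇u)`,
with norm `(‖u‖² + ‖∇u‖²)^{1/2}`. -/
abbrev PairSpace {n : ℕ} (Ω : Set (EuclideanSpace ℝ (Fin n))) (p : ℝ≥0∞) : Type :=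
  WithLp 2 (Lp ℝ p (volume.restrict Ω) ×
    Lp (EuclideanSpace ℝ (Fin n)) 2 (volume.restrict Ω))

/-- The pairs `(φ, ∇φ)` with `φ ∈ C_c^∞(Ω)`. -/
def testGraph {n : ℕ} (Ω : Set (EuclideanSpace ℝ (Fin n))) (p : ℝ≥0∞) [Fact (1 ≤ p)] :
    Submodule ℝ (PairSpace Ω p) where
  carrier := {w | ∃ φ : EuclideanSpace ℝ (Fin n) → ℝ, IsTestFunction Ω φ ∧
    (w.fst : EuclideanSpace ℝ (Fin n) → ℝ) =ᵐ[volume.restrict Ω] φ ∧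
    (w.snd : EuclideanSpace ℝ (Fin n) → EuclideanSpace ℝ (Fin n))
      =ᵐ[volume.restrict Ω] gradient φ}
  zero_mem' := by
    refine ⟨fun _ => 0, ⟨contDiff_const, HasCompactSupport.zero, ?_⟩, ?_, ?_⟩
    · simp [tsupport]
    · exact Lp.coeFn_zero _ _ _
    · filter_upwards [Lp.coeFn_zero (EuclideanSpace ℝ (Fin n)) 2 (volume.restrict Ω)] with x hx
      simpa [gradient] using hx
  add_mem' := by
    rintro v w ⟨φ, hφ, h1, h2⟩ ⟨ψ, hψ, k1, k2⟩
    refine ⟨φ + ψ, ⟨hφ.smooth.add hψ.smooth, hφ.compact.add hψ.compact, ?_⟩, ?_, ?_⟩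
    · exact (tsupport_add φ ψ).trans (union_subset hφ.supp hψ.supp)
    · filter_upwards [Lp.coeFn_add v.fst w.fst, h1, k1] with x hx hx1 hx2
      rw [WithLp.add_fst, hx, Pi.add_apply, Pi.add_apply, hx1, hx2]
    · filter_upwards [Lp.coeFn_add v.snd w.snd, h2, k2] with x hx hx1 hx2
      rw [WithLp.add_snd, hx, Pi.add_apply, hx1, hx2]
      have d1 : DifferentiableAt ℝ φ x := hφ.smooth.differentiable (by simp) x
      have d2 : DifferentiableAt ℝ ψ x := hψ.smooth.differentiable (by simp) x
      simp [gradient, fderiv_add d1 d2]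
  smul_mem' := by
    rintro c w ⟨φ, hφ, h1, h2⟩
    refine ⟨c • φ, ⟨contDiff_const.smul hφ.smooth, ?_, ?_⟩, ?_, ?_⟩
    · exact hφ.compact.smul_left (f := fun _ => c)
    · exact (tsupport_smul_subset_right (fun _ => c) φ).trans hφ.supp
    · filter_upwards [Lp.coeFn_smul c w.fst, h1] with x hx hx1
      rw [WithLp.smul_fst, hx, Pi.smul_apply, Pi.smul_apply, hx1]
    · filter_upwards [Lp.coeFn_smul c w.snd, h2] with x hx hx1
      rw [WithLp.smul_snd, hx, Pi.smul_apply, hx1]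
      have d1 : DifferentiableAt ℝ φ x := hφ.smooth.differentiable (by simp) x
      simp [gradient, fderiv_const_smul d1]

/-- The closure in `L^p(Ω) × L²(Ω; ℝⁿ)` of the pairs `(φ, ∇φ)` with `φ ∈ C_c^∞(Ω)`. Its elements
are the pairs `(u, ∇u)` (with `∇u` the weak gradient) for which there are test functions with
`φ_k → u` in `L^p(Ω)` and `∇φ_k → ∇u` in `L²(Ω)`. -/
def gradGraph {n : ℕ} (Ω : Set (EuclideanSpace ℝ (Fin n))) (p : ℝ≥0∞) [Fact (1 ≤ p)] :
    Submodule ℝ (PairSpace Ω p) :=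
  (testGraph Ω p).topologicalClosure

/-- The critical exponent `2^* = 2n/(n-2)`. -/
def critExp (n : ℕ) : ℝ≥0∞ := ENNReal.ofReal (2 * n / (n - 2))

instance one_le_critExp {n : ℕ} [hn : Fact (3 ≤ n)] : Fact (1 ≤ critExp n) := by
  constructor
  have h3 : (3 : ℝ) ≤ n := by exact_mod_cast hn.out
  rw [critExp, ENNReal.one_le_ofReal, le_div_iff₀ (by linarith)]
  linarith

/-- The space `H¹₀(Ω)` with the norm `‖∇u‖_{L²(Ω)}`: the completion of `C_c^∞(Ω)` for this norm,
realized (by the Sobolev inequality) as a space of functions in `L^{2^*}(Ω)`. -/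
def H10 {n : ℕ} [Fact (3 ≤ n)] (Ω : Set (EuclideanSpace ℝ (Fin n))) : Type :=
  gradGraph Ω (critExp n)

namespace H10

variable {n : ℕ} [Fact (3 ≤ n)] {Ω : Set (EuclideanSpace ℝ (Fin n))}

instance : AddCommGroup (H10 Ω) := inferInstanceAs (AddCommGroup (gradGraph Ω (critExp n)))

instance : Module ℝ (H10 Ω) := inferInstanceAs (Module ℝ (gradGraph Ω (critExp n)))

/-- The function `u` underlying an element of `H¹₀(Ω)`. -/
def fn (u : H10 Ω) : Lp ℝ (critExp n) (volume.restrict Ω) := u.1.fst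

/-- The gradient `∇u ∈ L²(Ω; ℝⁿ)` of an element of `H¹₀(Ω)`. -/
def grad : H10 Ω →ₗ[ℝ] Lp (EuclideanSpace ℝ (Fin n)) 2 (volume.restrict Ω) where
  toFun u := u.1.snd
  map_add' _ _ := rfl
  map_smul' _ _ := rfl

theorem sobolev_test : ∃ C : ℝ≥0, ∀ w ∈ testGraph Ω (critExp n),
    ‖w.fst‖ ≤ C * ‖w.snd‖ := by
  have hn : 3 ≤ n := Fact.out
  have h3 : (3 : ℝ) ≤ n := by exact_mod_cast hn
  let p' : ℝ≥0 := (2 * n / (n - 2) : ℝ).toNNReal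
  have hp' : (p' : ℝ≥0∞) = critExp n := rfl
  refine ⟨eLpNormLESNormFDerivOfEqInnerConst
    (volume : Measure (EuclideanSpace ℝ (Fin n))) (2 : ℝ≥0), ?_⟩
  rintro w ⟨φ, hφ, h1, h2⟩
  have key := eLpNorm_le_eLpNorm_fderiv_of_eq_inner
    (volume : Measure (EuclideanSpace ℝ (Fin n))) (u := φ) (p := 2) (p' := p')
    (hφ.smooth.of_le (by simp)) hφ.compact (by norm_num)
    (by simp; omega) (by
      have hpos : (0 : ℝ) ≤ 2 * n / (n - 2) := div_nonneg (by linarith) (by linarith)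
      simp only [finrank_euclideanSpace, Fintype.card_fin]
      rw [show ((p' : ℝ≥0) : ℝ) = 2 * n / (n - 2) from Real.coe_toNNReal _ hpos]
      have : (n : ℝ) - 2 ≠ 0 := by linarith
      have : (n : ℝ) ≠ 0 := by linarith
      push_cast
      field_simp)
  rw [ENNReal.coe_ofNat] at key
  rw [Lp.norm_def, Lp.norm_def, eLpNorm_congr_ae h1, eLpNorm_congr_ae h2]
  have hg : eLpNorm (gradient φ) 2 (volume.restrict Ω) = eLpNorm (fderiv ℝ φ) 2 volume := by
    have hs : Function.support (fun x => ‖fderiv ℝ φ x‖) ⊆ Ω := by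
      intro x hx
      by_contra hxΩ
      have h0 : fderiv ℝ φ x = 0 := by
        by_contra h
        exact hxΩ (hφ.supp (support_fderiv_subset ℝ h))
      simp [h0] at hx
    have e1 : eLpNorm (gradient φ) 2 (volume.restrict Ω)
        = eLpNorm (fun x => ‖fderiv ℝ φ x‖) 2 (volume.restrict Ω) :=
      eLpNorm_congr_norm_ae (Eventually.of_forall fun x => by simp [gradient])
    rw [e1, eLpNorm_restrict_eq_of_support_subset hs, eLpNorm_norm]
  have fin : eLpNorm (gradient φ) 2 (volume.restrict Ω) ≠ ∞ := by
    rw [← eLpNorm_congr_ae h2]; exact (Lp.memLp w.snd).2.ne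
  rw [← ENNReal.coe_toReal, ← ENNReal.toReal_mul]
  refine ENNReal.toReal_mono (ENNReal.mul_ne_top ENNReal.coe_ne_top fin) ?_
  rw [hg, ← hp']
  exact (eLpNorm_restrict_le φ p' volume Ω).trans key

theorem grad_injective : Function.Injective (grad (Ω := Ω)) := by
  obtain ⟨C, hC⟩ := sobolev_test (n := n) (Ω := Ω)
  have hcl : ∀ w ∈ gradGraph Ω (critExp n), ‖w.fst‖ ≤ C * ‖w.snd‖ := by
    have hclosed : IsClosed {w : PairSpace Ω (critExp n) | ‖w.fst‖ ≤ C * ‖w.snd‖} :=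
      isClosed_le (WithLp.prod_continuous_ofLp 2 _ _).fst.norm
        (continuous_const.mul (WithLp.prod_continuous_ofLp 2 _ _).snd.norm)
    intro w hw
    exact closure_minimal hC hclosed hw
  rw [injective_iff_map_eq_zero]
  intro u hu
  have h2 : u.1.snd = 0 := hu
  have h1 : u.1.fst = 0 := by
    have := hcl u.1 u.2
    rw [h2, norm_zero, mul_zero] at this
    exact norm_le_zero_iff.mp this
  exact Subtype.ext (WithLp.ofLp_injective 2 (Prod.ext h1 h2))

/-- The norm of `H¹₀(Ω)` is `‖u‖ = ‖∇u‖_{L²(Ω)}`. -/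
instance : NormedAddCommGroup (H10 Ω) :=
  NormedAddCommGroup.induced _ _ (grad (Ω := Ω)) grad_injective

instance : NormedSpace ℝ (H10 Ω) := NormedSpace.induced ℝ _ _ (grad (Ω := Ω))

end H10

/-- The closure of `C_c^∞(Ω)` in `H¹(Ω)`, with the norm `(‖u‖²_{L²} + ‖∇u‖²_{L²})^{1/2}`. -/
abbrev InhomH10 {n : ℕ} (Ω : Set (EuclideanSpace ℝ (Fin n))) : Type :=
  gradGraph Ω 2

/-- The function `u` underlying an element of `InhomH10 Ω`. -/
def InhomH10.fn {n : ℕ} {Ω : Set (EuclideanSpace ℝ (Fin n))} (u : InhomH10 Ω) :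
    Lp ℝ 2 (volume.restrict Ω) := u.1.fst

end YamabeRough

end

/-! The only information on `a` needed for boundedness is the weak bound |{|a| > σ}| ≤ W σ^(-n/2),
which follows from membership in any of the Lorentz spaces. By the layer-cake formula it gives ∫_E
|a| ≤ c W^(2/n) |E|^(1-2/n) for every E (`setLIntegral_le_of_meas_lt_le`).

Such an isocapacitary bound implies the trace inequality ∫ |a| φ² ≤ C W^(2/n) ∫ |∇φ|² by Maz'ya's
truncation (`exists_lintegral_sq_le_lintegral_fderiv_sq`). The Sobolev inequality, applied to a
smooth cutoff of φ² at level 2^k, bounds |{φ² ≥ 2^(k+1)}|^(1-2/n) by C 2^(-k) times the energy of φ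
in the shell 2^k ≤ φ² < 2^(k+1). The shells are disjoint, so the sum over k costs a single Dirichlet
integral. Density of test functions and Fatou's lemma extend the inequality to the whole space.

For d < ∞ the Lorentz integral converges, so its parts near t = 0 and t = ∞ are small, and the weak
bound holds with an arbitrarily small constant for very low and very high levels σ. Hence the weak
constant of `a`, and with it the trace constant, is small off F = {|a| ≤ M} ∩ B(0, R) for large M
and R (`hasSmallTails_weightedMeasure`). On F the weight is at most M, and averaging over a grid of
mesh 1/N is a finite rank approximation with squared error O(M/N²)
(`lintegral_enorm_sub_cellAverage_sq_le`). The embedding is therefore a norm limit of finite rank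
operators. -/

noncomputable section

namespace YamabeRough

/-! ### Weak-type bounds from Lorentz norms -/

section Lorentz

variable {n : ℕ} {Ω : Set (EuclideanSpace ℝ (Fin n))} {g : EuclideanSpace ℝ (Fin n) → ℝ}

theorem ofReal_le_rearrangement {σ t : ℝ} (h : ENNReal.ofReal t ≤ distrib Ω g σ) :
    ENNReal.ofReal σ ≤ rearrangement Ω g t := by
  refine le_iInf fun σ' => le_iInf₂ fun _ h' => ENNReal.ofReal_le_ofReal ?_
  by_contra! hlt
  refine absurd (h.trans (measure_mono ?_)) (not_le.mpr h')
  exact fun x hx => ⟨hx.1, hlt.trans hx.2⟩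

/-- The density whose integral defines the Lorentz quasi-norm. -/
def lorentzDensity (Ω : Set (EuclideanSpace ℝ (Fin n))) (g : EuclideanSpace ℝ (Fin n) → ℝ)
    (p d : ℝ) (t : ℝ) : ℝ≥0∞ :=
  rearrangement Ω g t ^ d * ENNReal.ofReal (t ^ (d / p - 1))

theorem lintegral_lorentzDensity_lt_top {p : ℝ} {d : ℝ≥0∞} (hd : 1 ≤ d) (hd' : d ≠ ∞)
    (h : MemLorentz Ω g p d) :
    ∫⁻ t in Ioi (0 : ℝ), lorentzDensity Ω g p d.toReal t < ∞ := by
  have h2 := h.2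
  rw [lorentzNorm, if_neg hd'] at h2
  have hpos : 0 < d.toReal := ENNReal.toReal_pos (by positivity) hd'
  exact (ENNReal.rpow_lt_top_iff_of_pos (by positivity)).mp h2

/-- For s in (t/2, t) the rearrangement is at least σ, and s^(d/p-1) = s^(d/p)/s ≥ (t/2)^(d/p)/t
whatever the sign of the exponent. Keeping only the integral near t, rather than all of it, is what
later yields small constants. -/
theorem mul_le_setLIntegral_lorentzDensity {p d σ t : ℝ} (hp : 0 < p) (hd : 0 < d) (hσ : 0 < σ)
    (ht : 0 < t) (h : ENNReal.ofReal t ≤ distrib Ω g σ) :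
    ENNReal.ofReal (σ ^ d * ((t / 2) ^ (d / p) / 2)) ≤
      ∫⁻ s in Ioo (t / 2) t, lorentzDensity Ω g p d s := by
  calc ENNReal.ofReal (σ ^ d * ((t / 2) ^ (d / p) / 2))
      = ENNReal.ofReal (σ ^ d * ((t / 2) ^ (d / p) / t)) * volume (Ioo (t / 2) t) := by
        rw [Real.volume_Ioo, ← ENNReal.ofReal_mul (by positivity)]
        congr 1
        field_simp
        ring
    _ = ∫⁻ s in Ioo (t / 2) t, ENNReal.ofReal (σ ^ d * ((t / 2) ^ (d / p) / t)) := by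
        rw [setLIntegral_const]
    _ ≤ _ := by
        refine setLIntegral_mono' measurableSet_Ioo fun s hs => ?_
        have hs0 : 0 < s := (half_pos ht).trans hs.1
        rw [ENNReal.ofReal_mul (by positivity), ← ENNReal.ofReal_rpow_of_pos hσ, lorentzDensity]
        gcongr ?_ ^ d * ENNReal.ofReal ?_
        · refine ofReal_le_rearrangement (le_trans ?_ h)
          exact ENNReal.ofReal_le_ofReal hs.2.le
        · rw [Real.rpow_sub hs0, Real.rpow_one]
          gcongr
          · exact hs.1.le
          · exact hs.2.le

theorem le_of_rpow_mul_le {p d σ t c : ℝ} (hp : 0 < p) (hd : 0 < d) (hσ : 0 < σ) (ht : 0 < t)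
    (h : σ ^ d * ((t / 2) ^ (d / p) / 2) ≤ c) : t ≤ 2 * (2 * c) ^ (p / d) * σ ^ (-p) := by
  have h1 : σ ^ d * (t / 2) ^ (d / p) ≤ 2 * c := by linarith
  have h2 := Real.rpow_le_rpow (by positivity) h1 (by positivity : 0 ≤ p / d)
  rw [Real.mul_rpow (by positivity) (by positivity), ← Real.rpow_mul hσ.le,
    ← Real.rpow_mul (by positivity), show d / p * (p / d) = 1 by field_simp,
    show d * (p / d) = p by field_simp, Real.rpow_one] at h2
  rw [Real.rpow_neg hσ.le, ← div_eq_mul_inv, le_div_iff₀ (by positivity)]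
  linarith

/-- Testing with real t ≤ m lets the level sets be estimated without knowing beforehand that their
measure is finite. -/
theorem le_ofReal_of_forall_le {m : ℝ≥0∞} {c : ℝ}
    (h : ∀ t : ℝ, 0 < t → ENNReal.ofReal t ≤ m → t ≤ c) : m ≤ ENNReal.ofReal c := by
  refine ENNReal.le_of_forall_nnreal_lt fun r hr => ?_
  rcases eq_or_ne r 0 with rfl | h0
  · simp
  · rw [← ENNReal.ofReal_coe_nnreal] at hr ⊢
    exact ENNReal.ofReal_le_ofReal (h _ (by positivity) hr.le)

theorem MemLorentz.exists_distrib_le {p : ℝ} {d : ℝ≥0∞} (hp : 0 < p) (hd : 1 ≤ d)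
    (h : MemLorentz Ω g p d) :
    ∃ W : ℝ, 0 < W ∧ ∀ σ : ℝ, 0 < σ → distrib Ω g σ ≤ ENNReal.ofReal (W * σ ^ (-p)) := by
  by_cases hd' : d = ∞
  · have h2 := h.2
    rw [lorentzNorm, if_pos hd'] at h2
    set N := ⨆ (t : ℝ) (_ : 0 < t), rearrangement Ω g t * ENNReal.ofReal (t ^ (1 / p)) with hN
    -- The added 1 only makes the constant positive; the same holds for `I.toReal + 1` in the case d
    -- < ∞.
    refine ⟨N.toReal ^ p + 1, by positivity, fun σ hσ => le_ofReal_of_forall_le fun t ht hm => ?_⟩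
    have h3 : ENNReal.ofReal (σ * t ^ (1 / p)) ≤ N := by
      rw [ENNReal.ofReal_mul hσ.le]
      refine le_trans ?_ (le_iSup₂ (f := fun (t : ℝ) (_ : 0 < t) =>
        rearrangement Ω g t * ENNReal.ofReal (t ^ (1 / p))) t ht)
      gcongr
      exact ofReal_le_rearrangement hm
    have h4 : σ * t ^ (1 / p) ≤ N.toReal := (ENNReal.ofReal_le_iff_le_toReal h2.ne).mp h3
    have h5 := Real.rpow_le_rpow (by positivity) h4 hp.le
    rw [Real.mul_rpow hσ.le (by positivity), ← Real.rpow_mul ht.le,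
      show 1 / p * p = 1 by field_simp, Real.rpow_one] at h5
    rw [Real.rpow_neg hσ.le, ← div_eq_mul_inv, le_div_iff₀ (by positivity)]
    linarith
  · have hpos : 0 < d.toReal := ENNReal.toReal_pos (by positivity) hd'
    have hI := lintegral_lorentzDensity_lt_top hd hd' h
    set I := ∫⁻ t in Ioi (0 : ℝ), lorentzDensity Ω g p d.toReal t
    refine ⟨2 * (2 * (I.toReal + 1)) ^ (p / d.toReal), by positivity,
      fun σ hσ => le_ofReal_of_forall_le fun t ht hm => ?_⟩
    refine le_of_rpow_mul_le hp hpos hσ ht (le_trans ?_ (by linarith : I.toReal ≤ _))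
    refine (ENNReal.ofReal_le_iff_le_toReal hI.ne).mp ?_
    refine (mul_le_setLIntegral_lorentzDensity hp hpos hσ ht hm).trans ?_
    exact lintegral_mono_set fun s hs => (half_pos ht).trans hs.1

/-- This is where d < ∞ enters: the integral of the density over (t/2, t) tends to 0 both as t → 0
and as t → ∞, and its size controls the weak constant at the corresponding level. -/
theorem MemLorentz.exists_distrib_le_small {p : ℝ} {d : ℝ≥0∞} (hp : 0 < p) (hd : 1 ≤ d)
    (hd' : d ≠ ∞) (h : MemLorentz Ω g p d) {ε : ℝ} (hε : 0 < ε) :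
    ∃ δ M : ℝ, 0 < δ ∧ 0 < M ∧ ∀ σ : ℝ, 0 < σ → σ ≤ δ ∨ M ≤ σ →
      distrib Ω g σ ≤ ENNReal.ofReal (ε * σ ^ (-p)) := by
  obtain ⟨W, hW, hWb⟩ := h.exists_distrib_le hp hd
  set e := d.toReal with he
  have hpos : 0 < e := ENNReal.toReal_pos (by positivity) hd'
  have hI := lintegral_lorentzDensity_lt_top hd hd' h
  -- Chosen so that the constant produced by `le_of_rpow_mul_le` is exactly ε.
  set c : ℝ := (ε / 2) ^ (e / p) / 2 with hc
  have hc0 : 0 < c := by positivity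
  have hcε : 2 * (2 * c) ^ (p / e) = ε := by
    rw [hc, mul_div_cancel₀ _ (two_ne_zero), ← Real.rpow_mul (by positivity),
      show e / p * (p / e) = 1 by field_simp, Real.rpow_one]
    ring
  -- a level is controlled as soon as the corresponding piece of the integral is small
  have key : ∀ σ t : ℝ, 0 < σ → 0 < t → ENNReal.ofReal t ≤ distrib Ω g σ →
      ∫⁻ s in Ioo (t / 2) t, lorentzDensity Ω g p e s ≤ ENNReal.ofReal c →
      t ≤ ε * σ ^ (-p) := by
    intro σ t hσ ht hm hG
    rw [← hcε]
    refine le_of_rpow_mul_le hp hpos hσ ht ?_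
    exact (ENNReal.ofReal_le_ofReal_iff hc0.le).mp
      ((mul_le_setLIntegral_lorentzDensity hp hpos hσ ht hm).trans hG)
  have hcne : ENNReal.ofReal c ≠ 0 := by simpa using hc0
  obtain ⟨T₀, hT₀, hsmall⟩ : ∃ T₀ : ℝ, 0 < T₀ ∧ ∀ t : ℝ, 0 < t → t ≤ T₀ →
      ∫⁻ s in Ioo (t / 2) t, lorentzDensity Ω g p e s ≤ ENNReal.ofReal c := by
    obtain ⟨η, hη, hη'⟩ := exists_pos_setLIntegral_lt_of_measure_lt hI.ne hcne
    obtain ⟨T, hT0, hT⟩ : ∃ T : ℝ, 0 < T ∧ ENNReal.ofReal T < η := by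
      obtain ⟨r, hr0, hr⟩ := ENNReal.lt_iff_exists_nnreal_btwn.mp hη
      exact ⟨r, by exact_mod_cast hr0, by simpa using hr⟩
    refine ⟨T, hT0, fun t ht htT => ?_⟩
    have := hη' (Ioo (t / 2) t) (by
      refine (Measure.restrict_apply_le _ _).trans_lt ?_
      rw [Real.volume_Ioo]
      exact (ENNReal.ofReal_le_ofReal (by linarith)).trans_lt hT)
    rw [Measure.restrict_restrict measurableSet_Ioo,
      inter_eq_left.mpr fun s (hs : s ∈ Ioo (t / 2) t) => show s ∈ Ioi (0 : ℝ) from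
        (half_pos ht).trans hs.1] at this
    exact this.le
  obtain ⟨T₁, hT₁, hlarge⟩ : ∃ T₁ : ℝ, 0 < T₁ ∧ ∀ t : ℝ, T₁ ≤ t →
      ∫⁻ s in Ioo (t / 2) t, lorentzDensity Ω g p e s ≤ ENNReal.ofReal c := by
    set ν := (volume.restrict (Ioi (0 : ℝ))).withDensity (lorentzDensity Ω g p e) with hν
    have : IsFiniteMeasure ν := isFiniteMeasure_withDensity hI.ne
    have htend : Tendsto (fun k : ℕ => ν (Ioi (k : ℝ))) atTop (𝓝 0) := by
      have h0 := tendsto_measure_iInter_atTop (μ := ν) (s := fun k : ℕ => Ioi (k : ℝ))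
        (fun k => measurableSet_Ioi.nullMeasurableSet)
        (fun i j hij => Ioi_subset_Ioi (by exact_mod_cast hij)) ⟨0, measure_ne_top _ _⟩
      have : ⋂ k : ℕ, Ioi (k : ℝ) = ∅ := by
        refine eq_empty_of_forall_notMem fun x hx => ?_
        obtain ⟨k, hk⟩ := exists_nat_ge x
        exact absurd (mem_iInter.mp hx k) (not_lt.mpr hk)
      rwa [this, measure_empty] at h0
    obtain ⟨k, hk⟩ := (htend.eventually_lt_const (pos_iff_ne_zero.mpr hcne)).exists
    refine ⟨2 * (k + 1), by positivity, fun t ht => ?_⟩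
    have ht0 : 0 < t := lt_of_lt_of_le (by positivity) ht
    rw [hν, withDensity_apply _ measurableSet_Ioi,
      Measure.restrict_restrict measurableSet_Ioi] at hk
    refine le_trans (lintegral_mono_set ?_) hk.le
    intro s hs
    have := hs.1
    exact ⟨show (k : ℝ) < s by linarith, (half_pos ht0).trans hs.1⟩
  have hinv : ∀ x : ℝ, 0 < x → (x ^ (-1 / p)) ^ (-p) = x := fun x hx => by
    rw [← Real.rpow_mul hx.le, show -1 / p * -p = 1 by field_simp, Real.rpow_one]
  -- The thresholds solve ε δ^(-p) = T₁ and W M^(-p) = T₀. For σ ≤ δ, a violation t > ε σ^(-p) would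
  -- force t ≥ T₁; for σ ≥ M, the weak bound already gives t ≤ T₀.
  refine ⟨(T₁ / ε) ^ (-1 / p), (T₀ / W) ^ (-1 / p), by positivity, by positivity,
    fun σ hσ hcase => le_ofReal_of_forall_le fun t ht hm => ?_⟩
  rcases hcase with hδ | hM
  · by_contra! hlt
    refine absurd (key σ t hσ ht hm (hlarge t (le_trans ?_ hlt.le))) (not_le.mpr hlt)
    have := Real.rpow_le_rpow_of_nonpos hσ hδ (by linarith : -p ≤ 0)
    rw [hinv _ (by positivity), div_le_iff₀ hε] at this
    linarith
  · refine key σ t hσ ht hm (hsmall t ht ?_)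
    have h1 : t ≤ W * σ ^ (-p) :=
      (ENNReal.ofReal_le_ofReal_iff (by positivity)).mp (hm.trans (hWb σ hσ))
    have := Real.rpow_le_rpow_of_nonpos (by positivity) hM (by linarith : -p ≤ 0)
    rw [hinv _ (by positivity), le_div_iff₀ hW] at this
    linarith

end Lorentz

/-! ### Integrals of weak-type functions over sets -/

section Layercake

variable {α : Type*} [MeasurableSpace α]

theorem setLIntegral_le_of_meas_lt_le {μ : Measure α} {f : α → ℝ} (hf : AEMeasurable f μ)
    (hf0 : ∀ x, 0 ≤ f x) {p W : ℝ} (hp : 1 < p) (hW : 0 < W)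
    (h : ∀ σ : ℝ, 0 < σ → μ {x | σ < f x} ≤ ENNReal.ofReal (W * σ ^ (-p))) (E : Set α) :
    ∫⁻ x in E, ENNReal.ofReal (f x) ∂μ ≤
      ENNReal.ofReal ((1 + 1 / (p - 1)) * W ^ (1 / p)) * μ E ^ (1 - 1 / p) := by
  have hp0 : 0 < p := by linarith
  have hp1 : 0 < p - 1 := by linarith
  have hexp : 0 < 1 - 1 / p := by
    rw [sub_pos, div_lt_one hp0]; exact hp
  rcases eq_or_ne (μ E) 0 with h0 | h0
  · rw [setLIntegral_measure_zero _ _ h0]; exact zero_le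
  rcases eq_or_ne (μ E) ∞ with ht | ht
  · have hc : ENNReal.ofReal ((1 + 1 / (p - 1)) * W ^ (1 / p)) ≠ 0 := by
      rw [Ne, ENNReal.ofReal_eq_zero, not_le]; positivity
    rw [ht, ENNReal.top_rpow_of_pos hexp, ENNReal.mul_top hc]
    exact le_top
  set m := (μ E).toReal with hm
  have hm0 : 0 < m := ENNReal.toReal_pos h0 ht
  have hmE : μ E = ENNReal.ofReal m := (ENNReal.ofReal_toReal ht).symm
  -- The level at which the trivial bound μ E and the weak bound W s^(-p) agree: the former is used
  -- below s, the latter above, where p > 1 makes it integrable.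
  set s := (W / m) ^ (1 / p) with hs
  have hs0 : 0 < s := by positivity
  have hsp : s ^ p = W / m := by
    rw [hs, ← Real.rpow_mul (by positivity), show 1 / p * p = 1 by field_simp, Real.rpow_one]
  rw [lintegral_eq_lintegral_meas_lt (μ.restrict E) (Eventually.of_forall hf0) hf.restrict,
    ← Ioc_union_Ioi_eq_Ioi hs0.le, lintegral_union measurableSet_Ioi Ioc_disjoint_Ioi_same]
  have h1 : ∫⁻ t in Ioc 0 s, (μ.restrict E) {x | t < f x} ≤ ENNReal.ofReal (m * s) := by
    calc ∫⁻ t in Ioc 0 s, (μ.restrict E) {x | t < f x} ≤ ∫⁻ _ in Ioc 0 s, μ E := by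
          refine lintegral_mono fun t => ?_
          simpa using measure_mono (μ := μ.restrict E) (subset_univ {x | t < f x})
      _ = ENNReal.ofReal (m * s) := by
          rw [setLIntegral_const, Real.volume_Ioc, hmE, ← ENNReal.ofReal_mul hm0.le, sub_zero]
  have h2 : ∫⁻ t in Ioi s, (μ.restrict E) {x | t < f x} ≤
      ENNReal.ofReal (m * s / (p - 1)) := by
    calc ∫⁻ t in Ioi s, (μ.restrict E) {x | t < f x}
        ≤ ∫⁻ t in Ioi s, ENNReal.ofReal (W * t ^ (-p)) :=
          setLIntegral_mono' measurableSet_Ioi fun t hts =>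
            (Measure.restrict_le_self _).trans (h t (hs0.trans hts))
      _ = ENNReal.ofReal (∫ t in Ioi s, W * t ^ (-p)) := by
          rw [ofReal_integral_eq_lintegral_ofReal]
          · exact (integrableOn_Ioi_rpow_of_lt (by linarith) hs0).const_mul W
          · filter_upwards [ae_restrict_mem measurableSet_Ioi] with t hts
            have : 0 < t := hs0.trans hts
            positivity
      _ = ENNReal.ofReal (m * s / (p - 1)) := by
          rw [integral_const_mul, integral_Ioi_rpow_of_lt (by linarith) hs0, Real.rpow_add hs0,
            Real.rpow_one, Real.rpow_neg hs0.le, hsp]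
          congr 1
          have : -p + 1 ≠ 0 := by linarith
          field_simp
          ring
  refine (add_le_add h1 h2).trans (le_of_eq ?_)
  rw [← ENNReal.ofReal_add (by positivity) (by positivity), hmE, ENNReal.ofReal_rpow_of_pos hm0,
    ← ENNReal.ofReal_mul (by positivity)]
  congr 1
  have hms : m * s = W ^ (1 / p) * m ^ (1 - 1 / p) := by
    rw [hs, Real.div_rpow hW.le hm0.le, Real.rpow_sub hm0, Real.rpow_one]
    ring
  rw [mul_assoc, ← hms]
  ring

end Layercake

/-! ### Trace inequality by smooth truncation -/

section Sobolev

variable {n : ℕ}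

theorem exists_eLpNorm_critExp_le [Fact (3 ≤ n)] :
    ∃ S : ℝ≥0, ∀ ψ : EuclideanSpace ℝ (Fin n) → ℝ, ContDiff ℝ 1 ψ → HasCompactSupport ψ →
      eLpNorm ψ (critExp n) volume ≤ S * eLpNorm (fderiv ℝ ψ) 2 volume := by
  have hn : 3 ≤ n := Fact.out
  have h3 : (3 : ℝ) ≤ n := by exact_mod_cast hn
  have hpos : (0 : ℝ) ≤ 2 * n / (n - 2) := div_nonneg (by linarith) (by linarith)
  refine ⟨eLpNormLESNormFDerivOfEqInnerConst
    (volume : Measure (EuclideanSpace ℝ (Fin n))) (2 : ℝ≥0), fun ψ hψ hc => ?_⟩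
  have key := eLpNorm_le_eLpNorm_fderiv_of_eq_inner
    (volume : Measure (EuclideanSpace ℝ (Fin n))) (u := ψ) (p := 2)
    (p' := (2 * n / (n - 2) : ℝ).toNNReal) hψ hc (by norm_num) (by simp; omega) (by
      simp only [finrank_euclideanSpace, Fintype.card_fin]
      rw [Real.coe_toNNReal _ hpos]
      have : (n : ℝ) - 2 ≠ 0 := by linarith
      have : (n : ℝ) ≠ 0 := by linarith
      push_cast
      field_simp)
  rwa [ENNReal.coe_ofNat] at key

/-- Outside [0, 1) the function takes its global minimum 0 or maximum 1. The half-open interval is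
what makes the dyadic shells disjoint. -/
theorem deriv_smoothTransition_eq_zero {x : ℝ} (hx : x ∉ Ico (0 : ℝ) 1) :
    deriv Real.smoothTransition x = 0 := by
  rcases lt_or_ge x 0 with h | h
  · refine IsLocalMin.deriv_eq_zero (Eventually.of_forall fun y => ?_)
    rw [Real.smoothTransition.zero_of_nonpos h.le]
    exact Real.smoothTransition.nonneg y
  · refine IsLocalMax.deriv_eq_zero (Eventually.of_forall fun y => ?_)
    rw [Real.smoothTransition.one_of_one_le (not_lt.mp fun h1 => hx ⟨h, h1⟩)]
    exact Real.smoothTransition.le_one y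

theorem exists_abs_deriv_smoothTransition_le :
    ∃ L : ℝ, 0 ≤ L ∧ ∀ x, |deriv Real.smoothTransition x| ≤ L := by
  have hcont : Continuous (deriv Real.smoothTransition) :=
    (Real.smoothTransition.contDiff (n := 1)).continuous_deriv le_rfl
  obtain ⟨L, hL⟩ := isCompact_Icc.exists_bound_of_continuousOn (s := Icc (0 : ℝ) 1)
    hcont.continuousOn
  refine ⟨max L 0, le_max_right _ _, fun x => ?_⟩
  by_cases hx : x ∈ Icc (0 : ℝ) 1
  · exact (hL x hx).trans (le_max_left _ _)
  · rw [deriv_smoothTransition_eq_zero fun h => hx (Ico_subset_Icc_self h), abs_zero]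
    exact le_max_right _ _

/-- A smooth function of `φ` that vanishes where `c φ² ≤ 1` and equals `1` where `c φ² ≥ 2`. -/
def levelCutoff (c : ℝ) (φ : EuclideanSpace ℝ (Fin n) → ℝ) (x : EuclideanSpace ℝ (Fin n)) : ℝ :=
  Real.smoothTransition (c * φ x ^ 2 - 1)

theorem contDiff_levelCutoff (c : ℝ) {φ : EuclideanSpace ℝ (Fin n) → ℝ} (hφ : ContDiff ℝ 1 φ) :
    ContDiff ℝ 1 (levelCutoff c φ) :=
  (Real.smoothTransition.contDiff (n := 1)).comp
    ((contDiff_const.mul (hφ.pow 2)).sub contDiff_const)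

theorem hasCompactSupport_levelCutoff (c : ℝ) {φ : EuclideanSpace ℝ (Fin n) → ℝ}
    (hφ : HasCompactSupport φ) : HasCompactSupport (levelCutoff c φ) :=
  hφ.comp_left (g := fun s => Real.smoothTransition (c * s ^ 2 - 1))
    (Real.smoothTransition.zero_of_nonpos (by norm_num))

theorem fderiv_levelCutoff (c : ℝ) {φ : EuclideanSpace ℝ (Fin n) → ℝ} (hφ : ContDiff ℝ 1 φ)
    (x : EuclideanSpace ℝ (Fin n)) :
    fderiv ℝ (levelCutoff c φ) x =
      (deriv Real.smoothTransition (c * φ x ^ 2 - 1) * (2 * c * φ x)) • fderiv ℝ φ x := by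
  have h1 : HasFDerivAt φ (fderiv ℝ φ x) x :=
    (hφ.differentiable one_ne_zero x).hasFDerivAt
  have h2 : HasFDerivAt (fun y => c * φ y ^ 2 - 1) (c • ((2 * φ x) • fderiv ℝ φ x)) x := by
    simpa using ((h1.pow 2).const_mul c).sub_const 1
  have h3 : HasDerivAt Real.smoothTransition
      (deriv Real.smoothTransition (c * φ x ^ 2 - 1)) (c * φ x ^ 2 - 1) :=
    ((Real.smoothTransition.contDiff (n := 1)).differentiable one_ne_zero _).hasDerivAt
  have h4 := (h3.comp_hasFDerivAt x h2).fderiv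
  rw [smul_smul, smul_smul] at h4
  rw [show levelCutoff c φ = Real.smoothTransition ∘ fun y => c * φ y ^ 2 - 1 from rfl, h4]
  congr 1
  ring

theorem eLpNorm_two_sq {E : Type*} [NormedAddCommGroup E] {α : Type*} [MeasurableSpace α]
    (μ : Measure α) (f : α → E) : eLpNorm f 2 μ ^ 2 = ∫⁻ x, ‖f x‖ₑ ^ 2 ∂μ := by
  have := eLpNorm_nnreal_pow_eq_lintegral (f := f) (μ := μ) (p := 2) two_ne_zero
  simpa using this

/-- Chebyshev and Sobolev for `levelCutoff c φ`. The exponent satisfies 1 - 2/n = 2/2^*. The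
gradient of the cutoff lives on the shell 1 ≤ c φ² < 2, where (2 c φ)² = 4 c (c φ²) ≤ 8 c; hence the
factor 8 L². -/
theorem exists_measure_level_rpow_le [Fact (3 ≤ n)] :
    ∃ C : ℝ≥0, ∀ φ : EuclideanSpace ℝ (Fin n) → ℝ, ContDiff ℝ 1 φ → HasCompactSupport φ →
      ∀ c : ℝ, 0 < c →
        volume {x | 2 ≤ c * φ x ^ 2} ^ (1 - 2 / n : ℝ) ≤
          C * ENNReal.ofReal c *
            ∫⁻ x in {x | c * φ x ^ 2 ∈ Ico (1 : ℝ) 2}, ‖fderiv ℝ φ x‖ₑ ^ 2 := by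
  obtain ⟨S, hS⟩ := exists_eLpNorm_critExp_le (n := n)
  obtain ⟨L, hL0, hL⟩ := exists_abs_deriv_smoothTransition_le
  have hn : 3 ≤ n := Fact.out
  have h3 : (3 : ℝ) ≤ n := by exact_mod_cast hn
  have hcrit : (critExp n).toReal = 2 * n / (n - 2) :=
    ENNReal.toReal_ofReal (div_nonneg (by linarith) (by linarith))
  refine ⟨S ^ 2 * (8 * L ^ 2).toNNReal, fun φ hφ hsupp c hc => ?_⟩
  have hmeas : MeasurableSet {x | c * φ x ^ 2 ∈ Ico (1 : ℝ) 2} :=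
    ((continuous_const.mul (hφ.continuous.pow 2)).measurable) measurableSet_Ico
  have hlevel : volume {x | 2 ≤ c * φ x ^ 2} ≤
      eLpNorm (levelCutoff c φ) (critExp n) volume ^ (critExp n).toReal := by
    refine le_trans (measure_mono ?_) ((mul_meas_ge_le_pow_eLpNorm' volume
      (p := critExp n) (one_pos.trans_le Fact.out).ne' ENNReal.ofReal_ne_top
      (contDiff_levelCutoff c hφ).continuous.aestronglyMeasurable 1).trans_eq' (by simp; rfl))
    intro x hx
    have hx : 2 ≤ c * φ x ^ 2 := hx
    have : levelCutoff c φ x = 1 := Real.smoothTransition.one_of_one_le (by linarith)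
    simp [this]
  calc volume {x | 2 ≤ c * φ x ^ 2} ^ (1 - 2 / n : ℝ)
      ≤ (eLpNorm (levelCutoff c φ) (critExp n) volume ^ (critExp n).toReal) ^ (1 - 2 / n : ℝ) := by
        refine ENNReal.rpow_le_rpow hlevel ?_
        rw [sub_nonneg, div_le_one (by linarith)]
        linarith
    _ = eLpNorm (levelCutoff c φ) (critExp n) volume ^ 2 := by
        rw [← ENNReal.rpow_mul, hcrit, ← ENNReal.rpow_two]
        congr 1
        have : (n : ℝ) - 2 ≠ 0 := by linarith
        field_simp
    _ ≤ (S * eLpNorm (fderiv ℝ (levelCutoff c φ)) 2 volume) ^ 2 := by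
        gcongr
        exact hS _ (contDiff_levelCutoff c hφ) (hasCompactSupport_levelCutoff c hsupp)
    _ = S ^ 2 * ∫⁻ x, ‖fderiv ℝ (levelCutoff c φ) x‖ₑ ^ 2 := by
        rw [mul_pow, eLpNorm_two_sq]
    _ ≤ S ^ 2 * ∫⁻ x, {x | c * φ x ^ 2 ∈ Ico (1 : ℝ) 2}.indicator
          (fun x => ENNReal.ofReal (8 * L ^ 2 * c) * ‖fderiv ℝ φ x‖ₑ ^ 2) x := by
        gcongr with x
        rw [fderiv_levelCutoff c hφ, enorm_smul, mul_pow]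
        by_cases hx : c * φ x ^ 2 ∈ Ico (1 : ℝ) 2
        · rw [indicator_of_mem (by exact hx)]
          gcongr
          rw [Real.enorm_eq_ofReal_abs, ← ENNReal.ofReal_pow (abs_nonneg _), sq_abs]
          refine ENNReal.ofReal_le_ofReal ?_
          have h1 : deriv Real.smoothTransition (c * φ x ^ 2 - 1) ^ 2 ≤ L ^ 2 :=
            sq_le_sq' (abs_le.mp (hL _)).1 (abs_le.mp (hL _)).2
          calc (deriv Real.smoothTransition (c * φ x ^ 2 - 1) * (2 * c * φ x)) ^ 2
              = deriv Real.smoothTransition (c * φ x ^ 2 - 1) ^ 2 * (4 * c * (c * φ x ^ 2)) := by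
                ring
            _ ≤ L ^ 2 * (4 * c * 2) := by
                gcongr
                exact hx.2.le
            _ = 8 * L ^ 2 * c := by ring
        · rw [deriv_smoothTransition_eq_zero]
          · rw [zero_mul, enorm_zero, zero_pow two_ne_zero, zero_mul]
            exact zero_le
          · intro h
            exact hx ⟨by linarith [h.1], by linarith [h.2]⟩
    _ = _ := by
        rw [lintegral_indicator hmeas, lintegral_const_mul' _ _ ENNReal.ofReal_ne_top,
          ENNReal.ofReal_mul (by positivity)]
        simp only [ENNReal.coe_mul, ENNReal.coe_pow, ENNReal.ofReal]
        ring

/-- A measure dominated by the power `1 - 2/n` of the Lebesgue measure satisfies the trace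
inequality `∫ φ² dν ≤ C κ ∫ |∇φ|²` on test functions. -/
theorem exists_lintegral_sq_le_lintegral_fderiv_sq [Fact (3 ≤ n)] :
    ∃ C : ℝ≥0, ∀ (ν : Measure (EuclideanSpace ℝ (Fin n))) (κ : ℝ≥0),
      (∀ E, MeasurableSet E → ν E ≤ κ * volume E ^ (1 - 2 / n : ℝ)) →
      ∀ φ : EuclideanSpace ℝ (Fin n) → ℝ, ContDiff ℝ 1 φ → HasCompactSupport φ →
        ∫⁻ x, ‖φ x‖ₑ ^ 2 ∂ν ≤ C * κ * ∫⁻ x, ‖fderiv ℝ φ x‖ₑ ^ 2 := by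
  obtain ⟨C, hC⟩ := exists_measure_level_rpow_le (n := n)
  refine ⟨4 * C, fun ν κ hν φ hφ hsupp => ?_⟩
  have hc : ∀ k : ℤ, (0 : ℝ) < 2 ^ (-k) := fun k => by positivity
  have hmeas : ∀ k : ℤ, MeasurableSet {x | 2 ≤ (2 : ℝ) ^ (-k) * φ x ^ 2} := fun k =>
    (isClosed_le continuous_const (continuous_const.mul (hφ.continuous.pow 2))).measurableSet
  have hmeas' : ∀ k : ℤ, MeasurableSet {x | (2 : ℝ) ^ (-k) * φ x ^ 2 ∈ Ico (1 : ℝ) 2} := fun k =>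
    ((continuous_const.mul (hφ.continuous.pow 2)).measurable) measurableSet_Ico
  have hdisj : Pairwise (Function.onFun Disjoint
      fun k : ℤ => {x | (2 : ℝ) ^ (-k) * φ x ^ 2 ∈ Ico (1 : ℝ) 2}) := by
    intro j k hjk
    refine disjoint_left.mpr fun x hj hk => ?_
    have e : ∀ k : ℤ, (2 : ℝ) ^ (-k) * φ x ^ 2 ∈ Ico (1 : ℝ) 2 →
        φ x ^ 2 ∈ Ico ((2 : ℝ) ^ k) (2 ^ (k + 1)) := by
      intro k h
      have h2 : (0 : ℝ) < 2 ^ k := by positivity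
      rw [zpow_neg, inv_mul_eq_div] at h
      rw [zpow_add_one₀ two_ne_zero]
      exact ⟨(one_le_div h2).mp h.1, by have := (div_lt_iff₀ h2).mp h.2; linarith⟩
    have hj' := e j hj
    have hk' := e k hk
    have h1 := (zpow_lt_zpow_iff_right₀ (one_lt_two (α := ℝ))).mp (hj'.1.trans_lt hk'.2)
    have h2 := (zpow_lt_zpow_iff_right₀ (one_lt_two (α := ℝ))).mp (hk'.1.trans_lt hj'.2)
    omega
  calc ∫⁻ x, ‖φ x‖ₑ ^ 2 ∂ν
      ≤ ∫⁻ x, ∑' k : ℤ, {x | 2 ≤ (2 : ℝ) ^ (-k) * φ x ^ 2}.indicator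
          (fun _ => ENNReal.ofReal (4 * 2 ^ k)) x ∂ν := by
        refine lintegral_mono fun x => ?_
        rcases eq_or_ne (φ x) 0 with h0 | h0
        · simp [h0]
        · obtain ⟨k, hk⟩ := exists_mem_Ico_zpow (x := φ x ^ 2) (y := (2 : ℝ)) (by positivity)
            one_lt_two
          -- A single term suffices: for index k - 1 the set is {φ² ≥ 2^k}, which contains x, and
          -- the weight is 4 · 2^(k-1) = 2^(k+1), which exceeds φ(x)².
          refine le_trans ?_ (ENNReal.le_tsum (k - 1))
          rw [indicator_of_mem]
          · rw [Real.enorm_eq_ofReal_abs, ← ENNReal.ofReal_pow (abs_nonneg _), sq_abs]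
            refine ENNReal.ofReal_le_ofReal (hk.2.le.trans (le_of_eq ?_))
            rw [zpow_add_one₀ two_ne_zero, zpow_sub_one₀ two_ne_zero]
            ring
          · rw [mem_ofPred_eq, neg_sub, sub_eq_add_neg, zpow_add₀ two_ne_zero, zpow_neg, zpow_one,
              mul_assoc, inv_mul_eq_div]
            have := (one_le_div (by positivity : (0 : ℝ) < 2 ^ k)).mpr hk.1
            linarith
    _ = ∑' k : ℤ, ENNReal.ofReal (4 * 2 ^ k) * ν {x | 2 ≤ (2 : ℝ) ^ (-k) * φ x ^ 2} := by
        rw [lintegral_tsum fun k => (measurable_const.indicator (hmeas k)).aemeasurable]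
        simp_rw [lintegral_indicator_const (hmeas _)]
    _ ≤ ∑' k : ℤ, (4 * C * κ * ∫⁻ x in {x | (2 : ℝ) ^ (-k) * φ x ^ 2 ∈ Ico (1 : ℝ) 2},
          ‖fderiv ℝ φ x‖ₑ ^ 2) := by
        refine ENNReal.tsum_le_tsum fun k => ?_
        calc _ ≤ ENNReal.ofReal (4 * 2 ^ k) * (κ * (C * ENNReal.ofReal (2 ^ (-k)) *
              ∫⁻ x in {x | (2 : ℝ) ^ (-k) * φ x ^ 2 ∈ Ico (1 : ℝ) 2}, ‖fderiv ℝ φ x‖ₑ ^ 2)) := by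
              gcongr
              exact (hν _ (hmeas k)).trans (by gcongr; exact hC φ hφ hsupp _ (hc k))
          _ = (ENNReal.ofReal (4 * 2 ^ k) * ENNReal.ofReal (2 ^ (-k))) * (C * κ *
              ∫⁻ x in {x | (2 : ℝ) ^ (-k) * φ x ^ 2 ∈ Ico (1 : ℝ) 2}, ‖fderiv ℝ φ x‖ₑ ^ 2) := by
              ring
          _ = _ := by
              rw [← ENNReal.ofReal_mul (by positivity), mul_assoc 4, ← zpow_add₀ two_ne_zero,
                add_neg_cancel, zpow_zero, mul_one, ENNReal.ofReal_ofNat]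
              ring
    _ ≤ _ := by
        -- The weight 4 · 2^k has cancelled the factor 2^(-k) of the level estimate, so the shell
        -- energies add up with a uniform constant.
        rw [ENNReal.tsum_mul_left, ← lintegral_iUnion hmeas' hdisj]
        push_cast
        gcongr
        exact Measure.restrict_le_self

end Sobolev

/-! ### Approximation by averages over a cubic grid -/

section GridAverage

variable {n : ℕ}

theorem enorm_integral_sq_le {α : Type*} [MeasurableSpace α] {μ : Measure α}
    [IsProbabilityMeasure μ] {f : α → ℝ} (hf : AEStronglyMeasurable f μ) :
    ‖∫ x, f x ∂μ‖ₑ ^ 2 ≤ ∫⁻ x, ‖f x‖ₑ ^ 2 ∂μ := by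
  rw [← eLpNorm_two_sq]
  gcongr
  calc ‖∫ x, f x ∂μ‖ₑ ≤ ∫⁻ x, ‖f x‖ₑ ∂μ := enorm_integral_le_lintegral_enorm f
    _ = eLpNorm f 1 μ := eLpNorm_one_eq_lintegral_enorm.symm
    _ ≤ eLpNorm f 2 μ := eLpNorm_le_eLpNorm_of_exponent_le one_le_two hf

/-- The fundamental theorem of calculus along the segment from x to x + z, Jensen in the parameter,
then Tonelli and translation invariance. -/
theorem lintegral_enorm_translate_sub_sq_le {φ : EuclideanSpace ℝ (Fin n) → ℝ}
    (hφ : ContDiff ℝ 1 φ) (z : EuclideanSpace ℝ (Fin n)) :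
    ∫⁻ x, ‖φ (x + z) - φ x‖ₑ ^ 2 ≤ ‖z‖ₑ ^ 2 * ∫⁻ x, ‖fderiv ℝ φ x‖ₑ ^ 2 := by
  have hD : Continuous (fderiv ℝ φ) := hφ.continuous_fderiv one_ne_zero
  have : IsProbabilityMeasure (volume.restrict (Ioc (0 : ℝ) 1)) :=
    ⟨by simp⟩
  have hpt : ∀ x, ‖φ (x + z) - φ x‖ₑ ^ 2 ≤
      ∫⁻ t in Ioc (0 : ℝ) 1, ‖z‖ₑ ^ 2 * ‖fderiv ℝ φ (x + t • z)‖ₑ ^ 2 := by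
    intro x
    have hcont : Continuous fun t : ℝ => fderiv ℝ φ (x + t • z) z := by fun_prop
    have hderiv : ∀ t ∈ uIcc (0 : ℝ) 1,
        HasDerivAt (fun t : ℝ => φ (x + t • z)) (fderiv ℝ φ (x + t • z) z) t := by
      intro t _
      have h1 : HasDerivAt (fun t : ℝ => x + t • z) z t := by
        simpa using ((hasDerivAt_id t).smul_const z).const_add x
      exact ((hφ.differentiable one_ne_zero _).hasFDerivAt).comp_hasDerivAt t h1
    have hftc := intervalIntegral.integral_eq_sub_of_hasDerivAt hderiv
      (hcont.intervalIntegrable _ _)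
    rw [one_smul, zero_smul, add_zero, intervalIntegral.integral_of_le zero_le_one] at hftc
    rw [← hftc]
    refine (enorm_integral_sq_le hcont.aestronglyMeasurable).trans (lintegral_mono fun t => ?_)
    rw [← mul_pow, mul_comm]
    gcongr
    exact ContinuousLinearMap.le_opENorm _ _
  calc ∫⁻ x, ‖φ (x + z) - φ x‖ₑ ^ 2
      ≤ ∫⁻ x, ∫⁻ t in Ioc (0 : ℝ) 1, ‖z‖ₑ ^ 2 * ‖fderiv ℝ φ (x + t • z)‖ₑ ^ 2 :=
        lintegral_mono hpt
    _ = ∫⁻ t in Ioc (0 : ℝ) 1, ∫⁻ x, ‖z‖ₑ ^ 2 * ‖fderiv ℝ φ (x + t • z)‖ₑ ^ 2 := by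
        refine lintegral_lintegral_swap (Continuous.aemeasurable ?_)
        have : Continuous fun q : EuclideanSpace ℝ (Fin n) × ℝ =>
            ‖fderiv ℝ φ (q.1 + q.2 • z)‖ₑ ^ 2 := by fun_prop
        exact (ENNReal.continuous_const_mul (by finiteness)).comp this
    _ = ∫⁻ t in Ioc (0 : ℝ) 1, ‖z‖ₑ ^ 2 * ∫⁻ x, ‖fderiv ℝ φ x‖ₑ ^ 2 := by
        refine lintegral_congr fun t => ?_
        rw [lintegral_const_mul' _ _ (by finiteness),
          lintegral_add_right_eq_self (fun x => ‖fderiv ℝ φ x‖ₑ ^ 2)]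
    _ = _ := by simp

/-- The index of the cell of the grid of mesh `1 / N` that contains `x`. -/
def gridIndex (N : ℝ) (x : EuclideanSpace ℝ (Fin n)) : Fin n → ℤ := fun i => ⌊N * x i⌋

/-- The cell with index `k` of the grid of mesh `1 / N`. -/
def gridCell (N : ℝ) (k : Fin n → ℤ) : Set (EuclideanSpace ℝ (Fin n)) :=
  {x | gridIndex N x = k}

theorem measurable_gridIndex (N : ℝ) : Measurable (gridIndex N (n := n)) := by
  refine measurable_pi_lambda _ fun i => Int.measurable_floor.comp ?_
  exact (continuous_const.mul (by fun_prop : Continuous fun x : EuclideanSpace ℝ (Fin n) =>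
    x i)).measurable

theorem measurableSet_gridCell (N : ℝ) (k : Fin n → ℤ) : MeasurableSet (gridCell N k) :=
  measurable_gridIndex N (measurableSet_singleton k)

theorem volume_gridCell {N : ℝ} (hN : 0 < N) (k : Fin n → ℤ) :
    volume (gridCell N k) = ENNReal.ofReal N⁻¹ ^ n := by
  have h : gridCell N k = WithLp.ofLp ⁻¹'
      (univ.pi fun i => Ico (k i / N) ((k i + 1) / N) : Set (Fin n → ℝ)) := by
    ext x
    simp only [gridCell, gridIndex, mem_ofPred_eq, funext_iff, Int.floor_eq_iff, mem_preimage,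
      Set.mem_pi, mem_univ, true_implies, mem_Ico, div_le_iff₀ hN, lt_div_iff₀ hN, mul_comm N]
  rw [h, (PiLp.volume_preserving_ofLp (Fin n)).measure_preimage
    (MeasurableSet.univ_pi fun i => measurableSet_Ico).nullMeasurableSet, Real.volume_pi_Ico]
  simp_rw [← sub_div, add_sub_cancel_left, one_div]
  simp

/-- The cube of side `2 / N` centred at the origin. -/
def gridBox (n : ℕ) (N : ℝ) : Set (EuclideanSpace ℝ (Fin n)) := {z | ∀ i, |z i| ≤ N⁻¹}

theorem gridBox_eq_preimage (N : ℝ) :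
    gridBox n N = WithLp.ofLp ⁻¹' (Icc (fun _ => -N⁻¹) (fun _ => N⁻¹) : Set (Fin n → ℝ)) := by
  ext z
  simp only [gridBox, mem_ofPred_eq, abs_le, mem_preimage, mem_Icc, Pi.le_def, forall_and]

theorem measurableSet_gridBox (N : ℝ) : MeasurableSet (gridBox n N) := by
  rw [gridBox_eq_preimage]
  exact (PiLp.volume_preserving_ofLp (Fin n)).measurable measurableSet_Icc

theorem volume_gridBox (N : ℝ) : volume (gridBox n N) = ENNReal.ofReal (2 * N⁻¹) ^ n := by
  rw [gridBox_eq_preimage, (PiLp.volume_preserving_ofLp (Fin n)).measure_preimage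
    measurableSet_Icc.nullMeasurableSet, Real.volume_Icc_pi]
  simp_rw [sub_neg_eq_add, ← two_mul]
  simp

theorem enorm_sq_le_of_mem_gridBox {N : ℝ} {z : EuclideanSpace ℝ (Fin n)}
    (hz : z ∈ gridBox n N) : ‖z‖ₑ ^ 2 ≤ ENNReal.ofReal (n / N ^ 2) := by
  rw [← ofReal_norm, ← ENNReal.ofReal_pow (norm_nonneg _), EuclideanSpace.norm_sq_eq]
  refine ENNReal.ofReal_le_ofReal ?_
  calc ∑ i, ‖z i‖ ^ 2 ≤ ∑ _i : Fin n, N⁻¹ ^ 2 := by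
        refine Finset.sum_le_sum fun i _ => ?_
        have := hz i
        rw [Real.norm_eq_abs]
        gcongr
    _ = n / N ^ 2 := by
        simp [div_eq_mul_inv]

theorem sub_mem_gridBox {N : ℝ} (hN : 0 < N) {x y : EuclideanSpace ℝ (Fin n)}
    (h : gridIndex N y = gridIndex N x) : y - x ∈ gridBox n N := by
  intro i
  have hi : |N * y i - N * x i| < 1 := Int.abs_sub_lt_one_of_floor_eq_floor (congrFun h i)
  rw [← mul_sub, abs_mul, abs_of_pos hN] at hi
  rw [PiLp.sub_apply, inv_eq_one_div, le_div_iff₀' hN]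
  exact hi.le

/-- The average of `φ` over the cell with index `k`. -/
def cellAverage (N : ℝ) (φ : EuclideanSpace ℝ (Fin n) → ℝ) (k : Fin n → ℤ) : ℝ :=
  N ^ n * ∫ x in gridCell N k, φ x

/-- By Jensen the error at x is at most the mean of |φ x - φ y|² over the cell of x. With y = x + z,
the translation estimate applies to each z. The factor 2^n is N^n times the volume of `gridBox`, and
n/N² bounds |z|² there. -/
theorem lintegral_enorm_sub_cellAverage_sq_le {N : ℝ} (hN : 0 < N)
    {φ : EuclideanSpace ℝ (Fin n) → ℝ} (hφ : ContDiff ℝ 1 φ) (hc : HasCompactSupport φ) :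
    ∫⁻ x, ‖φ x - cellAverage N φ (gridIndex N x)‖ₑ ^ 2 ≤
      ENNReal.ofReal (2 ^ n * n / N ^ 2) * ∫⁻ x, ‖fderiv ℝ φ x‖ₑ ^ 2 := by
  have hNn : (0 : ℝ) < N ^ n := by positivity
  have hpt : ∀ x, ‖φ x - cellAverage N φ (gridIndex N x)‖ₑ ^ 2 ≤
      ENNReal.ofReal (N ^ n) * ∫⁻ z in gridBox n N, ‖φ (x + z) - φ x‖ₑ ^ 2 := by
    intro x
    set Q := gridCell N (gridIndex N x)
    set μ := ENNReal.ofReal (N ^ n) • (volume.restrict Q) with hμ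
    have : IsProbabilityMeasure μ := by
      refine ⟨?_⟩
      rw [hμ, Measure.smul_apply, Measure.restrict_apply_univ, volume_gridCell hN,
        ← ENNReal.ofReal_pow (by positivity), smul_eq_mul, ← ENNReal.ofReal_mul hNn.le,
        inv_pow, mul_inv_cancel₀ hNn.ne', ENNReal.ofReal_one]
    have hint : Integrable φ μ :=
      ((hφ.continuous.integrable_of_hasCompactSupport hc).restrict).smul_measure
        ENNReal.ofReal_ne_top
    have havg : φ x - cellAverage N φ (gridIndex N x) = ∫ y, (φ x - φ y) ∂μ := by
      rw [integral_sub (integrable_const _) hint, integral_const, probReal_univ, one_smul, hμ,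
        integral_smul_measure, ENNReal.toReal_ofReal hNn.le, cellAverage, smul_eq_mul]
    rw [havg]
    refine (enorm_integral_sq_le (continuous_const.sub
      hφ.continuous).aestronglyMeasurable).trans ?_
    rw [hμ, lintegral_smul_measure, smul_eq_mul]
    refine mul_le_mul_right ?_ _
    -- Translating by x places the cell inside `gridBox`, a domain independent of x, so that the
    -- integrals in x and z can be exchanged.
    rw [← lintegral_indicator (measurableSet_gridCell _ _),
      ← lintegral_indicator (measurableSet_gridBox _),
      ← lintegral_add_left_eq_self (fun y => Q.indicator _ y) x]
    refine lintegral_mono fun z => ?_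
    by_cases hz : x + z ∈ Q
    · have hz' : z ∈ gridBox n N := by
        have := sub_mem_gridBox hN (show gridIndex N (x + z) = gridIndex N x from hz)
        rwa [add_sub_cancel_left] at this
      rw [indicator_of_mem hz, indicator_of_mem hz', enorm_sub_rev]
      exact le_rfl
    · rw [indicator_of_notMem hz]
      exact zero_le
  calc ∫⁻ x, ‖φ x - cellAverage N φ (gridIndex N x)‖ₑ ^ 2
      ≤ ∫⁻ x, ENNReal.ofReal (N ^ n) * ∫⁻ z in gridBox n N, ‖φ (x + z) - φ x‖ₑ ^ 2 :=
        lintegral_mono hpt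
    _ = ENNReal.ofReal (N ^ n) * ∫⁻ z in gridBox n N, ∫⁻ x, ‖φ (x + z) - φ x‖ₑ ^ 2 := by
        rw [lintegral_const_mul' _ _ ENNReal.ofReal_ne_top, lintegral_lintegral_swap]
        have := hφ.continuous
        exact Continuous.aemeasurable (by fun_prop)
    _ ≤ ENNReal.ofReal (N ^ n) * ∫⁻ _ in gridBox n N,
          ENNReal.ofReal (n / N ^ 2) * ∫⁻ x, ‖fderiv ℝ φ x‖ₑ ^ 2 := by
        refine mul_le_mul_right ?_ _
        refine setLIntegral_mono' (measurableSet_gridBox _) fun z hz => ?_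
        refine (lintegral_enorm_translate_sub_sq_le hφ z).trans ?_
        gcongr
        exact enorm_sq_le_of_mem_gridBox hz
    _ = _ := by
        rw [setLIntegral_const, volume_gridBox, ← ENNReal.ofReal_pow (by positivity),
          show ∀ a b c d : ℝ≥0∞, a * (b * c * d) = a * b * d * c by intros; ring,
          ← ENNReal.ofReal_mul hNn.le, ← ENNReal.ofReal_mul (by positivity)]
        congr 2
        rw [mul_pow, inv_pow]
        field_simp

end GridAverage

/-! ### Bounded and compact embeddings from trace inequalities -/

section Embedding

variable {n : ℕ} {Ω : Set (EuclideanSpace ℝ (Fin n))} {X : Type*} [NormedAddCommGroup X]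
  [NormedSpace ℝ X] {p : ℝ≥0∞} [Fact (1 ≤ p)]

/-- The elements of `X` that `J` maps to a test function whose Dirichlet energy is at most the
square of their norm. -/
def testElements (J : X →L[ℝ] Lp ℝ p (volume.restrict Ω)) : Set X :=
  {u | ∃ φ, IsTestFunction Ω φ ∧ J u =ᵐ[volume.restrict Ω] φ ∧
    ∫⁻ x, ‖fderiv ℝ φ x‖ₑ ^ 2 ≤ ‖u‖ₑ ^ 2}

/-- The trace inequality `∫ φ² dν ≤ K ∫ |∇φ|²` for test functions on `Ω`. -/
def TraceInequality (Ω : Set (EuclideanSpace ℝ (Fin n)))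
    (ν : Measure (EuclideanSpace ℝ (Fin n))) (K : ℝ≥0) : Prop :=
  ∀ φ, IsTestFunction Ω φ → ∫⁻ x, ‖φ x‖ₑ ^ 2 ∂ν ≤ K * ∫⁻ x, ‖fderiv ℝ φ x‖ₑ ^ 2

variable {J : X →L[ℝ] Lp ℝ p (volume.restrict Ω)}
  {ν : Measure (EuclideanSpace ℝ (Fin n))} {K : ℝ≥0}

/-- Approximating test elements converge in L^p, hence almost everywhere along a subsequence, also
for ν by absolute continuity. Fatou's lemma then suffices; convergence in L²(ν) is not needed. -/
theorem TraceInequality.lintegral_le (hK : TraceInequality Ω ν K)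
    (hν : ν ≪ volume.restrict Ω) (hJ : Dense (testElements J)) (u : X) :
    ∫⁻ x, ‖J u x‖ₑ ^ 2 ∂ν ≤ K * ‖u‖ₑ ^ 2 := by
  obtain ⟨v, hv, hvu⟩ := mem_closure_iff_seq_limit.mp (hJ u)
  obtain ⟨ns, hns, hae⟩ := (tendstoInMeasure_of_tendsto_Lp
    ((J.continuous.tendsto u).comp hvu)).exists_seq_tendsto_ae
  have hvb : ∀ k, ∫⁻ x, ‖J (v k) x‖ₑ ^ 2 ∂ν ≤ K * ‖v k‖ₑ ^ 2 := fun k => by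
    obtain ⟨φ, hφ, hJφ, hE⟩ := hv k
    calc ∫⁻ x, ‖J (v k) x‖ₑ ^ 2 ∂ν = ∫⁻ x, ‖φ x‖ₑ ^ 2 ∂ν :=
          lintegral_congr_ae ((hν.ae_eq hJφ).fun_comp fun y => ‖y‖ₑ ^ 2)
      _ ≤ K * ∫⁻ x, ‖fderiv ℝ φ x‖ₑ ^ 2 := hK φ hφ
      _ ≤ _ := by gcongr
  have hlim : Tendsto (fun k => (K : ℝ≥0∞) * ‖v (ns k)‖ₑ ^ 2) atTop (𝓝 (K * ‖u‖ₑ ^ 2)) := by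
    refine ENNReal.Tendsto.const_mul ?_ (Or.inr ENNReal.coe_ne_top)
    exact ((((ENNReal.continuous_pow 2).comp continuous_enorm).tendsto u).comp
      (hvu.comp hns.tendsto_atTop))
  calc ∫⁻ x, ‖J u x‖ₑ ^ 2 ∂ν
      = ∫⁻ x, liminf (fun k => ‖J (v (ns k)) x‖ₑ ^ 2) atTop ∂ν := by
        refine lintegral_congr_ae ?_
        filter_upwards [hν.ae_le hae] with x hx
        exact (((((ENNReal.continuous_pow 2).comp continuous_enorm).tendsto _).comp hx).liminf_eq).symm
    _ ≤ liminf (fun k => ∫⁻ x, ‖J (v (ns k)) x‖ₑ ^ 2 ∂ν) atTop :=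
        lintegral_liminf_le' fun k =>
          ((Lp.aestronglyMeasurable (J (v (ns k)))).mono_ac hν).enorm.pow_const 2
    _ ≤ liminf (fun k => (K : ℝ≥0∞) * ‖v (ns k)‖ₑ ^ 2) atTop :=
        liminf_le_liminf (Eventually.of_forall fun k => hvb _)
    _ = _ := hlim.liminf_eq

theorem TraceInequality.exists_clm (hK : TraceInequality Ω ν K)
    (hν : ν ≪ volume.restrict Ω) (hJ : Dense (testElements J)) :
    ∃ T : X →L[ℝ] Lp ℝ 2 ν, ∀ u, T u =ᵐ[ν] J u := by
  have hle : ∀ u, eLpNorm (J u) 2 ν ^ 2 ≤ K * ‖u‖ₑ ^ 2 := fun u => by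
    rw [eLpNorm_two_sq]
    exact hK.lintegral_le hν hJ u
  have hmem : ∀ u, MemLp (J u) 2 ν := fun u => by
    refine ⟨(Lp.aestronglyMeasurable (J u)).mono_ac hν, ?_⟩
    have : eLpNorm (J u) 2 ν ^ 2 < ∞ := (hle u).trans_lt (by finiteness)
    simpa using this
  refine ⟨LinearMap.mkContinuous
    { toFun := fun u => (hmem u).toLp
      map_add' := fun u v => ?_
      map_smul' := fun c u => ?_ } (NNReal.sqrt K) fun u => ?_, fun u => (hmem u).coeFn_toLp⟩
  · rw [← MemLp.toLp_add]
    refine MemLp.toLp_congr _ _ (hν.ae_eq ?_)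
    rw [map_add]
    exact Lp.coeFn_add _ _
  · rw [RingHom.id_apply, ← MemLp.toLp_const_smul]
    refine MemLp.toLp_congr _ _ (hν.ae_eq ?_)
    rw [map_smul]
    exact Lp.coeFn_smul _ _
  · change ‖(hmem u).toLp‖ ≤ _
    rw [← sq_le_sq₀ (norm_nonneg _) (by positivity), mul_pow, Lp.norm_toLp, ← ENNReal.toReal_pow]
    refine (ENNReal.toReal_mono (by finiteness) (hle u)).trans (le_of_eq ?_)
    rw [ENNReal.toReal_mul, ENNReal.toReal_pow, toReal_enorm]
    norm_cast
    simp

/-- Hölder on a set of finite measure. These functionals are the coefficients of the finite rank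
approximations. -/
theorem exists_clm_setIntegral {α : Type*} [MeasurableSpace α] {μ : Measure α} {Q : Set α}
    (hQ : μ Q ≠ ∞) : ∃ l : Lp ℝ p μ →L[ℝ] ℝ, ∀ f, l f = ∫ x in Q, f x ∂μ := by
  have : IsFiniteMeasure (μ.restrict Q) := ⟨by simpa [lt_top_iff_ne_top] using hQ⟩
  have hp : 1 ≤ p := Fact.out
  have hint : ∀ f : Lp ℝ p μ, Integrable f (μ.restrict Q) := fun f =>
    ((Lp.memLp f).restrict Q).integrable hp
  have hexp : 0 ≤ 1 / (1 : ℝ≥0∞).toReal - 1 / p.toReal := by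
    rcases eq_or_ne p ∞ with rfl | htop
    · simp
    · have h1 : 1 ≤ p.toReal := by simpa using ENNReal.toReal_mono htop hp
      simpa using inv_le_one_of_one_le₀ h1
  refine ⟨LinearMap.mkContinuous
    { toFun := fun f => ∫ x in Q, f x ∂μ
      map_add' := fun f g => ?_
      map_smul' := fun c f => ?_ }
      (μ Q ^ (1 / (1 : ℝ≥0∞).toReal - 1 / p.toReal)).toReal fun f => ?_, fun f => rfl⟩
  · rw [← integral_add (hint f) (hint g)]
    exact integral_congr_ae (ae_restrict_of_ae (Lp.coeFn_add f g))
  · rw [RingHom.id_apply, smul_eq_mul, ← integral_const_mul]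
    exact integral_congr_ae (ae_restrict_of_ae (Lp.coeFn_smul c f))
  · change ‖∫ x in Q, f x ∂μ‖ ≤ _
    rw [← toReal_enorm, Lp.norm_def, ← ENNReal.toReal_mul]
    refine ENNReal.toReal_mono (ENNReal.mul_ne_top (ENNReal.rpow_ne_top_of_nonneg hexp hQ)
      (Lp.eLpNorm_ne_top f)) ?_
    calc ‖∫ x in Q, f x ∂μ‖ₑ ≤ ∫⁻ x in Q, ‖f x‖ₑ ∂μ := enorm_integral_le_lintegral_enorm _
      _ = eLpNorm f 1 (μ.restrict Q) := eLpNorm_one_eq_lintegral_enorm.symm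
      _ ≤ eLpNorm f p (μ.restrict Q) *
          (μ.restrict Q) univ ^ (1 / (1 : ℝ≥0∞).toReal - 1 / p.toReal) :=
          eLpNorm_le_eLpNorm_mul_rpow_measure_univ hp (Lp.aestronglyMeasurable f).restrict
      _ ≤ _ := by
          rw [Measure.restrict_apply_univ, mul_comm]
          gcongr
          exact Measure.restrict_le_self

theorem isCompactOperator_sum_smulRight {ι Y : Type*} [NormedAddCommGroup Y] [NormedSpace ℝ Y]
    (s : Finset ι) (l : ι → X →L[ℝ] ℝ) (v : ι → Y) :
    IsCompactOperator (∑ k ∈ s, (l k).smulRight (v k) : X →L[ℝ] Y) := by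
  refine Finset.sum_induction _ (fun S : X →L[ℝ] Y => IsCompactOperator S)
    (fun S T hS hT => hS.add hT) isCompactOperator_zero fun k _ => ?_
  exact (isCompactOperator_of_locallyCompactSpace_dom (l k)).clm_comp
    ((ContinuousLinearMap.id ℝ ℝ).smulRight (v k))

/-- The measure `ν` is, up to a part with small trace constant, dominated by a multiple of the
Lebesgue measure on a bounded set. -/
def HasSmallTails (Ω : Set (EuclideanSpace ℝ (Fin n)))
    (ν : Measure (EuclideanSpace ℝ (Fin n))) : Prop :=
  ∀ ε : ℝ≥0, 0 < ε → ∃ (F : Set (EuclideanSpace ℝ (Fin n))) (R M : ℝ≥0), MeasurableSet F ∧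
    F ⊆ Metric.closedBall 0 R ∧ ν.restrict F ≤ M • volume ∧ TraceInequality Ω (ν.restrict Fᶜ) ε

theorem gridIndex_mem_Icc {N R : ℕ} {x : EuclideanSpace ℝ (Fin n)}
    (hx : x ∈ Metric.closedBall 0 (R : ℝ)) :
    gridIndex N x ∈ Finset.Icc (fun _ => -(N * R : ℤ)) (fun _ : Fin n => (N * R : ℤ)) := by
  rw [mem_closedBall_zero_iff] at hx
  have hi : ∀ i, |x i| ≤ R := fun i => (PiLp.norm_apply_le x i).trans hx
  have hN : (0 : ℝ) ≤ N := N.cast_nonneg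
  rw [Finset.mem_Icc, Pi.le_def, Pi.le_def]
  refine ⟨fun i => Int.le_floor.mpr ?_, fun i => Int.floor_le_iff.mpr ?_⟩
  · push_cast
    nlinarith [(abs_le.mp (hi i)).1]
  · push_cast
    nlinarith [(abs_le.mp (hi i)).2]

theorem IsTestFunction.contDiff_one {φ : EuclideanSpace ℝ (Fin n) → ℝ}
    (hφ : IsTestFunction Ω φ) : ContDiff ℝ 1 φ := hφ.smooth.of_le (by simp)

theorem IsTestFunction.setIntegral_eq {φ : EuclideanSpace ℝ (Fin n) → ℝ}
    (hφ : IsTestFunction Ω φ) {Q : Set (EuclideanSpace ℝ (Fin n))} (hQ : MeasurableSet Q) :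
    ∫ x in Q, φ x ∂(volume.restrict Ω) = ∫ x in Q, φ x := by
  rw [Measure.restrict_restrict hQ]
  refine (setIntegral_eq_of_subset_of_forall_sdiff_eq_zero hQ inter_subset_left
    fun x hx => ?_).symm
  exact image_eq_zero_of_notMem_tsupport fun h => hx.2 ⟨hx.1, hφ.supp h⟩

/-- S averages over grid cells and restricts to F. On F the error is controlled by the grid
estimate, since ν ≤ M dx there; off F one has S u = 0 and the trace constant ε applies. Each part
contributes ε. -/
theorem exists_isCompactOperator_approx (hν : ν ≪ volume.restrict Ω) {ε M R : ℝ≥0} (hε : 0 < ε)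
    {F : Set (EuclideanSpace ℝ (Fin n))} (hF : MeasurableSet F) (hFR : F ⊆ Metric.closedBall 0 R)
    (hFM : ν.restrict F ≤ M • volume) (hFc : TraceInequality Ω (ν.restrict Fᶜ) ε)
    {T : X →L[ℝ] Lp ℝ 2 ν} (hT : ∀ u, T u =ᵐ[ν] J u) :
    ∃ S : X →L[ℝ] Lp ℝ 2 ν, IsCompactOperator S ∧
      ∀ u ∈ testElements J, ‖T u - S u‖ₑ ^ 2 ≤ (2 * ε : ℝ≥0) * ‖u‖ₑ ^ 2 := by
  obtain ⟨R', hR'⟩ := exists_nat_ge R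
  obtain ⟨N, hN0, hN⟩ : ∃ N : ℕ, 0 < N ∧
      (M : ℝ≥0∞) * ENNReal.ofReal (2 ^ n * n / (N : ℝ) ^ 2) ≤ ε := by
    have h1 : Tendsto (fun N : ℕ => (2 ^ n * n : ℝ) / (N : ℝ) ^ 2) atTop (𝓝 0) :=
      tendsto_const_nhds.div_atTop
        ((tendsto_pow_atTop two_ne_zero).comp tendsto_natCast_atTop_atTop)
    have h2 : Tendsto (fun N : ℕ => (M : ℝ≥0∞) * ENNReal.ofReal (2 ^ n * n / (N : ℝ) ^ 2)) atTop
        (𝓝 0) := by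
      have := ENNReal.Tendsto.const_mul (a := (M : ℝ≥0∞)) (ENNReal.tendsto_ofReal h1)
        (Or.inr ENNReal.coe_ne_top)
      rwa [ENNReal.ofReal_zero, mul_zero] at this
    obtain ⟨N, h3, h4⟩ := ((h2.eventually_lt_const (ENNReal.coe_pos.mpr hε)).and
      (eventually_gt_atTop 0)).exists
    exact ⟨N, h4, h3.le⟩
  have hNr : (0 : ℝ) < N := by exact_mod_cast hN0
  have hvol : ∀ k, volume (gridCell N k : Set (EuclideanSpace ℝ (Fin n))) ≠ ∞ := fun k => by
    rw [volume_gridCell hNr]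
    finiteness
  have hfin : ∀ k, ν (gridCell N k ∩ F) ≠ ∞ := fun k => by
    rw [← Measure.restrict_apply (measurableSet_gridCell _ _)]
    refine ((hFM _).trans_lt ?_).ne
    exact ENNReal.mul_lt_top ENNReal.coe_lt_top (hvol k).lt_top
  choose l hl using fun k : Fin n → ℤ => exists_clm_setIntegral (p := p)
    (μ := volume.restrict Ω) (Q := gridCell N k)
    ((Measure.restrict_apply_le _ _).trans_lt (hvol k).lt_top).ne
  -- Only finitely many cells meet the bounded set F, which makes the rank finite.
  set s : Finset (Fin n → ℤ) :=
    Finset.Icc (fun _ => -(N * R' : ℤ)) (fun _ : Fin n => (N * R' : ℤ)) with hs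
  set L : (Fin n → ℤ) → X →L[ℝ] ℝ := fun k => (N : ℝ) ^ n • (l k ∘L J) with hL
  set v : (Fin n → ℤ) → Lp ℝ 2 ν := fun k =>
    indicatorConstLp 2 ((measurableSet_gridCell (N : ℝ) k).inter hF) (hfin k) (1 : ℝ) with hv
  refine ⟨∑ k ∈ s, (L k).smulRight (v k), isCompactOperator_sum_smulRight s L v, ?_⟩
  rintro u ⟨φ, hφ, hJφ, hE⟩
  -- The functional integrates over the part of the cell in Ω; this is the full cell average because
  -- φ vanishes off Ω.
  have hLφ : ∀ k, L k u = cellAverage N φ k := fun k => by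
    simp only [hL, smul_apply, ContinuousLinearMap.comp_apply, hl, smul_eq_mul,
      cellAverage]
    rw [← hφ.setIntegral_eq (measurableSet_gridCell _ _),
      integral_congr_ae (ae_restrict_of_ae hJφ)]
  -- the finite rank operator averages over the cells that meet `F`
  have hS : ((∑ k ∈ s, (L k).smulRight (v k) : X →L[ℝ] Lp ℝ 2 ν) u :
      EuclideanSpace ℝ (Fin n) → ℝ) =ᵐ[ν]
      F.indicator fun x => cellAverage N φ (gridIndex N x) := by
    have h1 : ((∑ k ∈ s, (L k).smulRight (v k) : X →L[ℝ] Lp ℝ 2 ν) u :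
        EuclideanSpace ℝ (Fin n) → ℝ) =ᵐ[ν] ∑ k ∈ s, ⇑(L k u • v k) := by
      rw [sum_apply]
      exact Lp.coeFn_finsetSum _ _
    have h2 : ∀ᵐ x ∂ν, ∀ k ∈ s, (L k u • v k : Lp ℝ 2 ν) x =
        (gridCell N k ∩ F).indicator (fun _ => cellAverage N φ k) x := by
      rw [eventually_all_finset]
      intro k _
      filter_upwards [Lp.coeFn_smul (L k u) (v k), indicatorConstLp_coeFn (p := 2) (μ := ν)
        (hs := (measurableSet_gridCell (N : ℝ) k).inter hF) (hμs := hfin k) (c := (1 : ℝ))]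
        with x hx1 hx2
      rw [hx1, Pi.smul_apply, hx2, hLφ]
      by_cases hx : x ∈ gridCell N k ∩ F
      · simp [hx]
      · simp [hx]
    filter_upwards [h1, h2] with x hx1 hx2
    rw [hx1, Finset.sum_apply, Finset.sum_congr rfl hx2]
    by_cases hx : x ∈ F
    · rw [indicator_of_mem hx, Finset.sum_eq_single_of_mem (gridIndex N x)]
      · rw [indicator_of_mem]
        exact ⟨rfl, hx⟩
      · refine gridIndex_mem_Icc (Metric.closedBall_subset_closedBall ?_ (hFR hx))
        exact_mod_cast hR'
      · intro k _ hk
        rw [indicator_of_notMem]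
        exact fun h => hk h.1.symm
    · rw [indicator_of_notMem hx]
      exact Finset.sum_eq_zero fun k _ => indicator_of_notMem (fun h => hx h.2) _
  have hae : (T u - (∑ k ∈ s, (L k).smulRight (v k) : X →L[ℝ] Lp ℝ 2 ν) u : Lp ℝ 2 ν) =ᵐ[ν]
      fun x => φ x - F.indicator (fun x => cellAverage N φ (gridIndex N x)) x := by
    filter_upwards [Lp.coeFn_sub (T u) ((∑ k ∈ s, (L k).smulRight (v k) : X →L[ℝ] Lp ℝ 2 ν) u),
      hT u, hν.ae_eq hJφ, hS] with x h1 h2 h3 h4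
    rw [h1, Pi.sub_apply, h2, h3, h4]
  rw [Lp.enorm_def, eLpNorm_congr_ae hae, eLpNorm_two_sq, ← lintegral_add_compl _ hF]
  have hin : ∫⁻ x in F, ‖φ x - F.indicator (fun x => cellAverage N φ (gridIndex N x)) x‖ₑ ^ 2 ∂ν ≤
      ε * ‖u‖ₑ ^ 2 := by
    calc _ = ∫⁻ x in F, ‖φ x - cellAverage N φ (gridIndex N x)‖ₑ ^ 2 ∂ν :=
          setLIntegral_congr_fun hF fun x hx => by simp only [indicator_of_mem hx]
      _ ≤ ∫⁻ x, ‖φ x - cellAverage N φ (gridIndex N x)‖ₑ ^ 2 ∂(M • volume) :=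
          lintegral_mono' hFM le_rfl
      _ ≤ M * (ENNReal.ofReal (2 ^ n * n / (N : ℝ) ^ 2) * ‖u‖ₑ ^ 2) := by
          rw [lintegral_smul_measure]
          refine mul_le_mul_right ((lintegral_enorm_sub_cellAverage_sq_le hNr hφ.contDiff_one
            hφ.compact).trans ?_) _
          gcongr
      _ ≤ ε * ‖u‖ₑ ^ 2 := by
          rw [← mul_assoc]
          gcongr
  have hout : ∫⁻ x in Fᶜ, ‖φ x - F.indicator (fun x => cellAverage N φ (gridIndex N x)) x‖ₑ ^ 2 ∂ν ≤
      ε * ‖u‖ₑ ^ 2 := by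
    calc _ = ∫⁻ x in Fᶜ, ‖φ x‖ₑ ^ 2 ∂ν :=
          setLIntegral_congr_fun hF.compl fun x hx => by
            simp only [indicator_of_notMem (show x ∉ F from hx), sub_zero]
      _ ≤ ε * ∫⁻ x, ‖fderiv ℝ φ x‖ₑ ^ 2 := hFc φ hφ
      _ ≤ _ := by gcongr
  refine (add_le_add hin hout).trans (le_of_eq ?_)
  push_cast
  ring

/-- Compact operators are closed in operator norm, and the approximation bound extends from the
dense set of test elements by continuity. -/
theorem HasSmallTails.isCompactOperator (h : HasSmallTails Ω ν) (hν : ν ≪ volume.restrict Ω)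
    (hJ : Dense (testElements J)) {T : X →L[ℝ] Lp ℝ 2 ν} (hT : ∀ u, T u =ᵐ[ν] J u) :
    IsCompactOperator T := by
  refine isClosed_setOfPred_isCompactOperator.closure_subset
    (Metric.mem_closure_iff.mpr fun δ hδ => ?_)
  lift δ to ℝ≥0 using hδ.le
  have hδ' : 0 < δ := by exact_mod_cast hδ
  -- With ε = δ²/8 the squared error is 2ε = (δ/2)², so the operator norm of T - S is at most δ/2 <
  -- δ.
  obtain ⟨F, R, M, hF, hFR, hFM, hFc⟩ := h (δ ^ 2 / 8) (by positivity)
  obtain ⟨S, hS, hSb⟩ := exists_isCompactOperator_approx (J := J) hν (by positivity) hF hFR hFM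
    hFc hT
  refine ⟨S, hS, ?_⟩
  rw [dist_eq_norm]
  refine lt_of_le_of_lt (ContinuousLinearMap.opNorm_le_bound _ (by positivity : 0 ≤ (δ / 2 : ℝ))
    fun u => ?_) (half_lt_self hδ)
  refine hJ.induction (P := fun u => ‖(T - S) u‖ ≤ δ / 2 * ‖u‖) (fun u hu => ?_)
    (isClosed_le (T - S).continuous.norm (continuous_const.mul continuous_norm)) u
  rw [← sq_le_sq₀ (norm_nonneg _) (by positivity), sub_apply]
  have h1 := ENNReal.toReal_mono (by finiteness) (hSb u hu)
  rw [ENNReal.toReal_mul, ENNReal.toReal_pow, ENNReal.toReal_pow, toReal_enorm, toReal_enorm,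
    ENNReal.coe_toReal] at h1
  refine h1.trans (le_of_eq ?_)
  push_cast
  ring

end Embedding

/-! ### The weighted measure of a Lorentz function -/

section Weighted

variable {n : ℕ} {Ω : Set (EuclideanSpace ℝ (Fin n))} {a b : EuclideanSpace ℝ (Fin n) → ℝ}

theorem weightedMeasure_absolutelyContinuous : weightedMeasure Ω a ≪ volume.restrict Ω :=
  withDensity_absolutelyContinuous _ _

theorem weightedMeasure_congr (h : a =ᵐ[volume.restrict Ω] b) :
    weightedMeasure Ω a = weightedMeasure Ω b :=
  withDensity_congr_ae (h.fun_comp fun y => ENNReal.ofReal |y|)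

theorem distrib_eq (hΩ : MeasurableSet Ω) (σ : ℝ) :
    distrib Ω a σ = volume.restrict Ω {x | σ < |a x|} := by
  rw [Measure.restrict_apply' hΩ, inter_comm]
  rfl

theorem distrib_congr (hΩ : MeasurableSet Ω) (h : a =ᵐ[volume.restrict Ω] b) (σ : ℝ) :
    distrib Ω a σ = distrib Ω b σ := by
  rw [distrib_eq hΩ, distrib_eq hΩ]
  refine measure_congr ?_
  filter_upwards [h] with x hx
  exact congrArg (fun y => σ < |y|) hx

/-- C depends on neither `a`, Ω nor G, so a small weak constant on G gives a small trace constant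
there. -/
theorem exists_traceInequality_of_weak [Fact (3 ≤ n)] :
    ∃ C : ℝ, 0 < C ∧ ∀ (a : EuclideanSpace ℝ (Fin n) → ℝ) (Ω G : Set (EuclideanSpace ℝ (Fin n))),
      AEMeasurable a (volume.restrict Ω) → MeasurableSet G → ∀ W : ℝ, 0 < W →
      (∀ σ : ℝ, 0 < σ → (volume.restrict Ω).restrict G {x | σ < |a x|} ≤
        ENNReal.ofReal (W * σ ^ (-(n / 2 : ℝ)))) →
      TraceInequality Ω ((weightedMeasure Ω a).restrict G)
        (C * W ^ (1 / (n / 2 : ℝ))).toNNReal := by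
  obtain ⟨C, hC⟩ := exists_lintegral_sq_le_lintegral_fderiv_sq (n := n)
  have hn : 3 ≤ n := Fact.out
  have h3 : (3 : ℝ) ≤ n := by exact_mod_cast hn
  have hn1 : (0 : ℝ) < n / 2 - 1 := by linarith
  set c : ℝ := 1 + 1 / (n / 2 - 1 : ℝ) with hc
  have hc0 : 0 < c := by positivity
  refine ⟨(C + 1) * c, by positivity, fun a Ω G ha hG W hW hweak φ hφ => ?_⟩
  have hκ := hC ((weightedMeasure Ω a).restrict G) (c * W ^ (1 / (n / 2 : ℝ))).toNNReal
    (fun E hE => by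
      rw [weightedMeasure, restrict_withDensity hG, withDensity_apply _ hE]
      refine (setLIntegral_le_of_meas_lt_le (ha.restrict.abs) (fun x => abs_nonneg _)
        (by linarith : (1 : ℝ) < n / 2) hW hweak E).trans ?_
      rw [← hc, one_div_div]
      refine mul_le_mul_right (ENNReal.rpow_le_rpow ?_ ?_) _
      · exact (Measure.restrict_le_self _).trans (Measure.restrict_le_self _)
      · rw [sub_nonneg, div_le_one (by linarith)]
        linarith)
    φ hφ.contDiff_one hφ.compact
  refine hκ.trans ?_
  gcongr
  rw [← ENNReal.coe_mul, ENNReal.coe_le_coe, mul_assoc,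
    Real.toNNReal_mul (by positivity : (0 : ℝ) ≤ C + 1)]
  gcongr
  rw [← NNReal.coe_le_coe, Real.coe_toNNReal _ (by positivity)]
  linarith

theorem MemLorentz.exists_traceInequality [Fact (3 ≤ n)] (hΩ : MeasurableSet Ω) {d : ℝ≥0∞}
    (hd : 1 ≤ d) (ha : MemLorentz Ω a ((n : ℝ) / 2) d) :
    ∃ K : ℝ≥0, TraceInequality Ω (weightedMeasure Ω a) K := by
  have hn : 3 ≤ n := Fact.out
  have h3 : (3 : ℝ) ≤ n := by exact_mod_cast hn
  obtain ⟨C, -, hC⟩ := exists_traceInequality_of_weak (n := n)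
  obtain ⟨W, hW, hWb⟩ := ha.exists_distrib_le (by linarith) hd
  refine ⟨(C * W ^ (1 / (n / 2 : ℝ))).toNNReal, ?_⟩
  have := hC a Ω univ ha.1 MeasurableSet.univ W hW fun σ hσ => by
    rw [Measure.restrict_univ, ← distrib_eq hΩ]
    exact hWb σ hσ
  rwa [Measure.restrict_univ] at this

/-- Off F = {|a| ≤ M} ∩ B(0, R), the set {|a| > σ} is covered by {|a| > max σ M} and the part of
{|a| > σ} outside the ball; each gets half of the weak constant W. The second piece needs R only for
δ < σ < M, since the other levels are covered by `hsmall`. -/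
theorem hasSmallTails_weightedMeasure [Fact (3 ≤ n)] (hΩ : MeasurableSet Ω) (ha : Measurable a)
    (hfin : ∀ σ : ℝ, 0 < σ → distrib Ω a σ < ∞)
    (hsmall : ∀ ε : ℝ, 0 < ε → ∃ δ M : ℝ, 0 < δ ∧ 0 < M ∧ ∀ σ : ℝ, 0 < σ → σ ≤ δ ∨ M ≤ σ →
      distrib Ω a σ ≤ ENNReal.ofReal (ε * σ ^ (-(n / 2 : ℝ)))) :
    HasSmallTails Ω (weightedMeasure Ω a) := by
  intro ε hε
  have hn : 3 ≤ n := Fact.out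
  have h3 : (3 : ℝ) ≤ n := by exact_mod_cast hn
  obtain ⟨C, hC0, hC⟩ := exists_traceInequality_of_weak (n := n)
  -- The weak constant whose associated trace constant is exactly ε.
  set W : ℝ := (ε / C) ^ (n / 2 : ℝ) with hW
  have hW0 : 0 < W := by positivity
  have hCW : (C * W ^ (1 / (n / 2 : ℝ))).toNNReal = ε := by
    rw [hW, ← Real.rpow_mul (by positivity), mul_one_div_cancel (by positivity), Real.rpow_one,
      mul_div_cancel₀ _ hC0.ne', Real.toNNReal_coe]
  obtain ⟨δ, M, hδ, hM, hb⟩ := hsmall (W / 2) (by positivity)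
  -- {|a| > δ} has finite measure in Ω, so little of it lies far out. The bound at level M serves
  -- all σ in (δ, M), where σ^(-n/2) is larger.
  obtain ⟨R, hR⟩ : ∃ R : ℕ, (volume.restrict Ω).restrict {x | δ < |a x|}
      (Metric.closedBall 0 (R : ℝ))ᶜ ≤ ENNReal.ofReal (W / 2 * M ^ (-(n / 2 : ℝ))) := by
    set μ := (volume.restrict Ω).restrict {x | δ < |a x|} with hμ
    have hμfin : IsFiniteMeasure μ := ⟨by
      rw [hμ, Measure.restrict_apply_univ, ← distrib_eq hΩ]
      exact hfin δ hδ⟩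
    have htend := tendsto_measure_iInter_atTop (μ := μ)
      (s := fun k : ℕ => (Metric.closedBall (0 : EuclideanSpace ℝ (Fin n)) (k : ℝ))ᶜ)
      (fun k => measurableSet_closedBall.compl.nullMeasurableSet)
      (fun i j hij => compl_subset_compl.mpr
        (Metric.closedBall_subset_closedBall (by exact_mod_cast hij))) ⟨0, measure_ne_top _ _⟩
    rw [← compl_iUnion, Metric.iUnion_closedBall_nat, compl_univ, measure_empty] at htend
    have hpos : 0 < ENNReal.ofReal (W / 2 * M ^ (-(n / 2 : ℝ))) :=
      ENNReal.ofReal_pos.mpr (by positivity)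
    obtain ⟨k, hk⟩ := (htend.eventually_lt_const hpos).exists
    exact ⟨k, hk.le⟩
  have hmeas : ∀ σ : ℝ, MeasurableSet {x | σ < |a x|} := fun σ =>
    measurableSet_lt measurable_const ha.abs
  set F : Set (EuclideanSpace ℝ (Fin n)) := {x | M < |a x|}ᶜ ∩ Metric.closedBall 0 (R : ℝ) with hF
  have hFm : MeasurableSet F := (hmeas M).compl.inter measurableSet_closedBall
  refine ⟨F, R, M.toNNReal, hFm, inter_subset_right, ?_, ?_⟩
  · rw [weightedMeasure, restrict_withDensity hFm]
    refine Measure.le_iff.mpr fun E hE => ?_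
    rw [withDensity_apply _ hE, Measure.restrict_restrict hE]
    calc ∫⁻ x in E ∩ F, ENNReal.ofReal |a x| ∂(volume.restrict Ω)
        ≤ ∫⁻ _ in E ∩ F, ENNReal.ofReal M ∂(volume.restrict Ω) :=
          setLIntegral_mono' (hE.inter hFm) fun x hx =>
            ENNReal.ofReal_le_ofReal (not_lt.mp hx.2.1)
      _ = ENNReal.ofReal M * volume.restrict Ω (E ∩ F) := setLIntegral_const _ _
      _ ≤ ENNReal.ofReal M * volume E := by
          exact mul_le_mul_right
            ((Measure.restrict_le_self _).trans (measure_mono inter_subset_left)) _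
  · rw [← hCW]
    refine hC a Ω Fᶜ ha.aemeasurable hFm.compl W hW0 fun σ hσ => ?_
    have hmono : ∀ s t : ℝ, 0 < s → s ≤ t → W / 2 * t ^ (-(n / 2 : ℝ)) ≤
        W / 2 * s ^ (-(n / 2 : ℝ)) := fun s t hs hst =>
      mul_le_mul_of_nonneg_left (Real.rpow_le_rpow_of_nonpos hs hst (by linarith)) (by positivity)
    have hhigh : volume.restrict Ω {x | max σ M < |a x|} ≤
        ENNReal.ofReal (W / 2 * σ ^ (-(n / 2 : ℝ))) := by
      rw [← distrib_eq hΩ]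
      exact (hb _ (lt_max_of_lt_left hσ) (Or.inr (le_max_right _ _))).trans
        (ENNReal.ofReal_le_ofReal (hmono _ _ hσ (le_max_left _ _)))
    have hfar : volume.restrict Ω ({x | σ < |a x|} ∩ (Metric.closedBall 0 (R : ℝ))ᶜ) ≤
        ENNReal.ofReal (W / 2 * σ ^ (-(n / 2 : ℝ))) := by
      by_cases hcase : σ ≤ δ ∨ M ≤ σ
      · refine (measure_mono inter_subset_left).trans ?_
        rw [← distrib_eq hΩ]
        exact hb σ hσ hcase
      · push Not at hcase
        rw [Measure.restrict_apply measurableSet_closedBall.compl] at hR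
        refine (measure_mono ?_).trans
          (hR.trans (ENNReal.ofReal_le_ofReal (hmono _ _ hσ hcase.2.le)))
        exact fun x hx => ⟨hx.2, hcase.1.trans hx.1⟩
    rw [Measure.restrict_apply (hmeas σ)]
    calc volume.restrict Ω ({x | σ < |a x|} ∩ Fᶜ)
        ≤ volume.restrict Ω ({x | max σ M < |a x|} ∪
            ({x | σ < |a x|} ∩ (Metric.closedBall 0 (R : ℝ))ᶜ)) := by
          refine measure_mono fun x hx => ?_
          by_cases hxb : x ∈ Metric.closedBall (0 : EuclideanSpace ℝ (Fin n)) (R : ℝ)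
          · refine Or.inl (show max σ M < |a x| from max_lt hx.1 ?_)
            by_contra hMx
            exact hx.2 ⟨hMx, hxb⟩
          · exact Or.inr ⟨hx.1, hxb⟩
      _ ≤ _ := measure_union_le _ _
      _ ≤ _ := add_le_add hhigh hfar
      _ = _ := by
          rw [← ENNReal.ofReal_add (by positivity) (by positivity)]
          congr 1
          ring

theorem MemLorentz.hasSmallTails [Fact (3 ≤ n)] (hΩ : MeasurableSet Ω) {d : ℝ≥0∞}
    (hd : 1 ≤ d) (hd' : d ≠ ∞) (ha : MemLorentz Ω a ((n : ℝ) / 2) d) :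
    HasSmallTails Ω (weightedMeasure Ω a) := by
  have hn : 3 ≤ n := Fact.out
  have h3 : (3 : ℝ) ≤ n := by exact_mod_cast hn
  have hp : (0 : ℝ) < n / 2 := by linarith
  -- A measurable representative makes the level sets, and hence F, measurable.
  rw [weightedMeasure_congr ha.1.ae_eq_mk]
  refine hasSmallTails_weightedMeasure hΩ ha.1.measurable_mk (fun σ hσ => ?_) fun ε hε => ?_
  · obtain ⟨W, -, hW⟩ := ha.exists_distrib_le hp hd
    rw [← distrib_congr hΩ ha.1.ae_eq_mk]
    exact (hW σ hσ).trans_lt ENNReal.ofReal_lt_top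
  · simp_rw [← distrib_congr hΩ ha.1.ae_eq_mk]
    exact ha.exists_distrib_le_small hp hd hd' hε

variable {X : Type*} [NormedAddCommGroup X] [NormedSpace ℝ X] {p : ℝ≥0∞} [Fact (1 ≤ p)]

theorem norm_sq_eq_setIntegral (ha : AEMeasurable a (volume.restrict Ω)) (w : WeightedL2 Ω a)
    {f : EuclideanSpace ℝ (Fin n) → ℝ} (hf : AEStronglyMeasurable f (volume.restrict Ω))
    (h : w =ᵐ[weightedMeasure Ω a] f) :
    IntegrableOn (fun x => |a x| * |f x| ^ 2) Ω ∧ ‖w‖ ^ 2 = ∫ x in Ω, |a x| * |f x| ^ 2 := by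
  have hnn : ∀ x, 0 ≤ |a x| * |f x| ^ 2 := fun x => by positivity
  have hm : AEStronglyMeasurable (fun x => |a x| * |f x| ^ 2) (volume.restrict Ω) :=
    (ha.abs.mul (hf.aemeasurable.abs.pow_const 2)).aestronglyMeasurable
  have key : ‖w‖ₑ ^ 2 = ∫⁻ x in Ω, ENNReal.ofReal (|a x| * |f x| ^ 2) := by
    rw [Lp.enorm_def, eLpNorm_congr_ae h, eLpNorm_two_sq, weightedMeasure,
      lintegral_withDensity_eq_lintegral_mul₀ ha.abs.ennreal_ofReal (hf.enorm.pow_const 2)]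
    refine lintegral_congr fun x => ?_
    rw [Pi.mul_apply, ENNReal.ofReal_mul (abs_nonneg _), ENNReal.ofReal_pow (abs_nonneg _),
      Real.enorm_eq_ofReal_abs]
  constructor
  · refine ⟨hm, ?_⟩
    rw [hasFiniteIntegral_iff_ofReal (Eventually.of_forall hnn), ← key]
    finiteness
  · rw [integral_eq_lintegral_of_nonneg_ae (Eventually.of_forall hnn) hm, ← key,
      ENNReal.toReal_pow, toReal_enorm]

theorem MemLorentz.exists_embedding [Fact (3 ≤ n)] (hΩ : MeasurableSet Ω) {d : ℝ≥0∞}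
    (hd : 1 ≤ d) (ha : MemLorentz Ω a ((n : ℝ) / 2) d)
    {J : X →L[ℝ] Lp ℝ p (volume.restrict Ω)} (hJ : Dense (testElements J)) :
    ∃ T : X →L[ℝ] WeightedL2 Ω a,
      (∀ u : X, T u =ᵐ[weightedMeasure Ω a] J u ∧
        IntegrableOn (fun x => |a x| * |J u x| ^ 2) Ω ∧
        ‖T u‖ ^ 2 = ∫ x in Ω, |a x| * |J u x| ^ 2) ∧
      (d ≠ ∞ → IsCompactOperator T) := by
  obtain ⟨K, hK⟩ := ha.exists_traceInequality hΩ hd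
  obtain ⟨T, hT⟩ := hK.exists_clm weightedMeasure_absolutelyContinuous hJ
  exact ⟨T, fun u => ⟨hT u, norm_sq_eq_setIntegral ha.1 _ (Lp.aestronglyMeasurable _) (hT u)⟩,
    fun hd' => (ha.hasSmallTails hΩ hd hd').isCompactOperator
      weightedMeasure_absolutelyContinuous hJ hT⟩

end Weighted

/-! ### The two versions of H¹₀ -/

section Spaces

variable {n : ℕ} {Ω : Set (EuclideanSpace ℝ (Fin n))}

theorem lintegral_enorm_fderiv_sq_eq {p : ℝ≥0∞} {w : PairSpace Ω p}
    {φ : EuclideanSpace ℝ (Fin n) → ℝ} (hφ : IsTestFunction Ω φ)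
    (h : w.snd =ᵐ[volume.restrict Ω] gradient φ) :
    ∫⁻ x, ‖fderiv ℝ φ x‖ₑ ^ 2 = ‖w.snd‖ₑ ^ 2 := by
  have hg : ∀ x, ‖gradient φ x‖ₑ = ‖fderiv ℝ φ x‖ₑ := fun x => by
    simp [enorm_eq_nnnorm, gradient]
  rw [Lp.enorm_def, eLpNorm_congr_ae h, eLpNorm_two_sq]
  simp_rw [← hg]
  refine (setLIntegral_eq_of_support_subset fun x hx => ?_).symm
  by_contra hxΩ
  refine hx ?_
  have h0 : fderiv ℝ φ x = 0 := by
    by_contra hne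
    exact hxΩ (hφ.supp (support_fderiv_subset ℝ hne))
  simp [gradient, h0]

theorem exists_clm_H10_fn [Fact (3 ≤ n)] :
    ∃ J : H10 Ω →L[ℝ] Lp ℝ (critExp n) (volume.restrict Ω), ∀ u, J u = u.fn := by
  obtain ⟨C, hC⟩ := H10.sobolev_test (n := n) (Ω := Ω)
  have hclosed : IsClosed {w : PairSpace Ω (critExp n) | ‖w.fst‖ ≤ C * ‖w.snd‖} :=
    isClosed_le (WithLp.prod_continuous_ofLp 2 _ _).fst.norm
      (continuous_const.mul (WithLp.prod_continuous_ofLp 2 _ _).snd.norm)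
  refine ⟨LinearMap.mkContinuous
    { toFun := fun u : H10 Ω => u.fn
      map_add' := fun _ _ => rfl
      map_smul' := fun _ _ => rfl } C fun u => ?_, fun u => rfl⟩
  -- The Sobolev inequality is a closed condition on pairs, so it passes from test functions to
  -- their closure.
  exact closure_minimal hC hclosed u.2

/-- Convergence of pairs contains convergence of gradients, which is convergence in this norm; the
energy of a test function equals its squared norm. -/
theorem dense_testElements_H10 [Fact (3 ≤ n)]
    {J : H10 Ω →L[ℝ] Lp ℝ (critExp n) (volume.restrict Ω)} (hJ : ∀ u, J u = u.fn) :
    Dense (testElements J) := by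
  intro u
  obtain ⟨w, hw, hwu⟩ := mem_closure_iff_seq_limit.mp (show u.1 ∈ closure _ from u.2)
  have hex : ∀ k, ∃ v : H10 Ω, v.1 = w k := fun k =>
    ⟨⟨w k, (testGraph Ω (critExp n)).le_topologicalClosure (hw k)⟩, rfl⟩
  choose v hv using hex
  refine mem_closure_iff_seq_limit.mpr ⟨v, fun k => ?_, ?_⟩
  · obtain ⟨φ, hφ, h1, h2⟩ := hw k
    rw [← hv k] at h1 h2
    refine ⟨φ, hφ, ?_, (lintegral_enorm_fderiv_sq_eq hφ h2).le⟩
    rw [hJ]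
    exact h1
  · rw [tendsto_iff_norm_sub_tendsto_zero]
    have h2 : Tendsto (fun k => (v k).1.snd) atTop (𝓝 u.1.snd) := by
      simp_rw [hv]
      exact ((WithLp.prod_continuous_ofLp 2 _ _).snd.tendsto _).comp hwu
    have h3 := tendsto_iff_norm_sub_tendsto_zero.mp h2
    exact h3

theorem exists_clm_inhomH10_fn :
    ∃ J : InhomH10 Ω →L[ℝ] Lp ℝ 2 (volume.restrict Ω), ∀ u, J u = InhomH10.fn u :=
  ⟨{ toFun := fun u => InhomH10.fn u
     map_add' := fun _ _ => rfl
     map_smul' := fun _ _ => rfl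
     cont := ((WithLp.prod_continuous_ofLp 2 _ _).fst).comp continuous_subtype_val }, fun _ => rfl⟩

theorem dense_testElements_inhomH10
    {J : InhomH10 Ω →L[ℝ] Lp ℝ 2 (volume.restrict Ω)} (hJ : ∀ u, J u = InhomH10.fn u) :
    Dense (testElements J) := by
  intro u
  obtain ⟨w, hw, hwu⟩ := mem_closure_iff_seq_limit.mp (show u.1 ∈ closure _ from u.2)
  refine mem_closure_iff_seq_limit.mpr
    ⟨fun k => ⟨w k, (testGraph Ω 2).le_topologicalClosure (hw k)⟩, fun k => ?_,
      tendsto_subtype_rng.mpr hwu⟩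
  obtain ⟨φ, hφ, h1, h2⟩ := hw k
  refine ⟨φ, hφ, ?_, (lintegral_enorm_fderiv_sq_eq hφ h2).le.trans ?_⟩
  · rw [hJ]
    exact h1
  -- In the inhomogeneous norm the energy is only bounded by the squared norm, which is why
  -- `testElements` asks for an inequality.
  · gcongr
    rw [enorm_le_iff_norm_le]
    exact WithLp.norm_snd_le _ _

end Spaces

end YamabeRough

end

theorem theorem1p3 (n : ℕ) [Fact (3 ≤ n)] (Ω : Set (EuclideanSpace ℝ (Fin n)))
    (hΩ : IsOpen Ω) (d : ℝ≥0∞) (hd : 1 ≤ d) (a : EuclideanSpace ℝ (Fin n) → ℝ)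
    (ha : YamabeRough.MemLorentz Ω a ((n : ℝ) / 2) d) :
    (∃ T : YamabeRough.H10 Ω →L[ℝ] YamabeRough.WeightedL2 Ω a,
      (∀ u : YamabeRough.H10 Ω,
        (T u : EuclideanSpace ℝ (Fin n) → ℝ) =ᵐ[YamabeRough.weightedMeasure Ω a] u.fn ∧
        IntegrableOn (fun x => |a x| * |u.fn x| ^ 2) Ω ∧
        ‖T u‖ ^ 2 = ∫ x in Ω, |a x| * |u.fn x| ^ 2) ∧
      (d ≠ ∞ → IsCompactOperator T)) ∧
    (∃ T : YamabeRough.InhomH10 Ω →L[ℝ] YamabeRough.WeightedL2 Ω a,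
      (∀ u : YamabeRough.InhomH10 Ω,
        (T u : EuclideanSpace ℝ (Fin n) → ℝ) =ᵐ[YamabeRough.weightedMeasure Ω a] u.fn ∧
        IntegrableOn (fun x => |a x| * |u.fn x| ^ 2) Ω ∧
        ‖T u‖ ^ 2 = ∫ x in Ω, |a x| * |u.fn x| ^ 2) ∧
      (d ≠ ∞ → IsCompactOperator T)) := by
  obtain ⟨J, hJ⟩ := YamabeRough.exists_clm_H10_fn (n := n) (Ω := Ω)
  obtain ⟨J', hJ'⟩ := YamabeRough.exists_clm_inhomH10_fn (n := n) (Ω := Ω)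
  have h := ha.exists_embedding hΩ.measurableSet hd (YamabeRough.dense_testElements_H10 hJ)
  have h' := ha.exists_embedding hΩ.measurableSet hd (YamabeRough.dense_testElements_inhomH10 hJ')
  simp only [hJ] at h
  simp only [hJ'] at h'
  exact ⟨h, h'⟩
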